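/- Let $\mathbb T=\biguplus_{n\ge 0}\mathbb R^n$ be the space of traces, with the disjoint-union topology and $\sigma$-algebra and the measure $\mu_{\mathbb T}=\sum_n\mathcal N_n$, where $\mathcal N_n$ is the standard normal distribution on $\mathbb R^n$. For $q\in\mathbb R^n$ and $k\le n$ let $q^{1\dots k}$ be its prefix of length $k$. Let $w:\mathbb T\to[0,\infty)$ be measurable and suppose that * $w$ is tree representable: if $w(q)>0$ for some $q\in\mathbb R^n$, then $w(q^{1\dots k})=0$ for all $k<n$; * $w$ is $\mu_{\mathbb T}$-integrable and $\mu_{\mathbb T}$-almost everywhere continuously differentiable; * almost every infinite sequence (of independent standard normals) has a finite prefix on which $w$ is positive. Let $\mathrm{supp}(w)=\{w>0\}$, let $\nu(B)=\frac1Z\int_B w\,d\mu_{\mathbb T}$ with $Z=\int_{\mathbb T}w\,d\mu_{\mathbb T}$ be the target distribution, and put $w_{\le n}(q)=\sum_{k\le n}w(q^{1\dots k})$ for $q\in\mathbb R^n$ and $U_n=-\log w_{\le n}$, with domain $\{w_{\le n}>0\}$. Let $\varepsilon>0$ be a step size and $L\ge1$ a number of steps. Let $\Psi_n$ be the integrator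 on $\mathbb R^n\times\mathbb R^n$ that performs $L$ leapfrog steps $$p'=p-\tfrac\varepsilon2\nabla U_n(q),\qquad \tilde q=q+\varepsilon p',\qquad \tilde p=p'-\tfrac\varepsilon2\nabla U_n(\tilde q)$$ and then flips the sign of the momentum (the gradient is read as $0$ where it does not exist). A state $(q,p)\in\mathbb R^n\times\mathbb R^n$ is valid if its initial position and its positions after each of the $L$ leapfrog steps lie in the domain of $U_n$, and if this fails in dimension $k$ for $(q^{1\dots k},p^{1\dots k})$, for every $k<n$. For a valid state, $f(q,p)$ is the unique prefix of $q$ in $\mathrm{supp}(w)$. The marginalised NP-HMC kernel $Q(q,B)$, for $q\in\mathrm{supp}(w)\cap\mathbb R^n$ and measurable $B\subseteq\mathbb T$, is the probability that the following procedure returns an element of $B$. Draw a standard normal momentum in $\mathbb R^n$, and keep appending independent standard normal coordinates to the position $q$ and to the momentum until the state $s_0=(q_0,p_0)$ so obtained is valid, in dimension $N$ say. Then return $f(\Psi_N(s_0))$ with probability $$\min\Bigl\{1,\frac{w_{\le N}(q_1)\,\varphi_{2N}(q_1,p_1)}{w_{\le N}(q_0)\,\varphi_{2N}(q_0,p_0)}\Bigr\},\qquad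 (q_1,p_1)=\Psi_N(s_0),$$ and $f(s_0)=q$ otherwise, where $\varphi_{2N}$ is the standard normal density. Assume that there is a measurable set $A\subseteq\mathbb T$ with $\mu_{\mathbb T}(A)>0$, $\mu_{\mathbb T}(\mathbb T\setminus A)=0$ and $\mu_{\mathbb T}(\partial A)=0$ such that * (C1) $w$ is continuously differentiable on $A$; * (C2) there is $c>0$ with $w\ge c$ on $\mathrm{supp}(w)$; * (C3) there are constants $M_1,M_2$, not depending on $n$, such that for every $n$ all coordinates of $\nabla w_{\le n}/w_{\le n}$ lie in $[M_1,M_2]$ at all points of $\mathrm{supp}(w_{\le n})\cap A$ at which the gradient exists; * (C4) for every $n$, the function $\nabla w_{\le n}/w_{\le n}$ is Lipschitz continuous on the set of these points. Then, for every $\varepsilon>0$ and every $L\ge1$, the kernel $Q$ is $\nu$-aperiodic: there are no $d\ge1$ and pairwise disjoint measurable sets $B_0,\dots,B_d\subseteq\mathrm{supp}(w)$ with $\nu(B_0)>0$ such that $Q(x,B_{(i+1)\bmod(d+1)})=1$ for all $i=0,\dots,d$ and all $x\in B_i$. -/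

import Mathlib

open MeasureTheory ProbabilityTheory

namespace NPHMC

noncomputable section

/-! Traces, the trace measure and the target distribution -/

/-- The space of traces: the disjoint union of all `ℝⁿ`, with the disjoint-union topology and
σ-algebra. -/
abbrev Trace : Type := Σ n : ℕ, (Fin n → ℝ)

/-- The standard normal distribution on `ℝⁿ`. -/
def stdNormal (n : ℕ) : Measure (Fin n → ℝ) := Measure.pi fun _ => gaussianReal 0 1

/-- The trace measure: the sum over `n` of the standard normals on `ℝⁿ`. -/
def traceMeasure : Measure Trace := Measure.sum fun n => (stdNormal n).map (Sigma.mk n)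

/-- The prefix of length `k` of a vector of length `n`. -/
def pre {n k : ℕ} (q : Fin n → ℝ) (h : k ≤ n) : Fin k → ℝ := fun i => q (Fin.castLE h i)

/-- `w` is tree representable: no proper prefix of a `w`-supported trace is `w`-supported. -/
def TreeRepresentable (w : Trace → ℝ) : Prop :=
  ∀ (n : ℕ) (q : Fin n → ℝ), 0 < w ⟨n, q⟩ → ∀ (k : ℕ) (hk : k < n), ¬ 0 < w ⟨k, pre q hk.le⟩

/-- The target distribution, with density `w / Z` with respect to the trace measure. -/
def target (w : Trace → ℝ) : Measure Trace :=
  (ENNReal.ofReal (∫ t, w t ∂traceMeasure))⁻¹ •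
    traceMeasure.withDensity fun t => ENNReal.ofReal (w t)

/-- The truncation `w_{≤ n}` on `ℝⁿ`: the sum of `w` over all prefixes. -/
def trunc (w : Trace → ℝ) (n : ℕ) (q : Fin n → ℝ) : ℝ :=
  ∑ k : Fin (n + 1), w ⟨k, pre q (Nat.le_of_lt_succ k.isLt)⟩

/-- The vector of partial derivatives. -/
def grad {n : ℕ} (f : (Fin n → ℝ) → ℝ) (q : Fin n → ℝ) : Fin n → ℝ :=
  fun i => fderiv ℝ f q (Pi.single i 1)

/-! The algorithm -/

/-- The potential energy `U_n = - log w_{≤ n}`, a partial function with domain `{w_{≤ n} > 0}`. -/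
def potential (w : Trace → ℝ) (n : ℕ) (q : Fin n → ℝ) : ℝ := - Real.log (trunc w n q)

/-- The gradient of `U_n`, as `- ∇ w_{≤ n} / w_{≤ n}`. It agrees with the gradient of `potential` at
every point of the domain of `U_n` at which `w_{≤ n}` is differentiable (see `gradU_eq`). -/
def gradU (w : Trace → ℝ) (n : ℕ) (q : Fin n → ℝ) : Fin n → ℝ :=
  fun i => - (grad (trunc w n) q i / trunc w n q)

theorem gradU_eq (w : Trace → ℝ) (n : ℕ) (q : Fin n → ℝ) (hq : 0 < trunc w n q)
    (hd : DifferentiableAt ℝ (trunc w n) q) : gradU w n q = grad (potential w n) q := by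
  funext i
  have h := (hd.hasFDerivAt.log hq.ne').neg
  have h' : fderiv ℝ (potential w n) q = -((trunc w n q)⁻¹ • fderiv ℝ (trunc w n) q) := h.fderiv
  simp only [gradU, grad, h', neg_apply, smul_apply,
    smul_eq_mul]
  rw [div_eq_inv_mul]

/-- One leapfrog step of size `ε` for the potential `U_n`. -/
def leapfrog (w : Trace → ℝ) (ε : ℝ) (n : ℕ) (s : (Fin n → ℝ) × (Fin n → ℝ)) :
    (Fin n → ℝ) × (Fin n → ℝ) :=
  let p' := s.2 - (ε / 2) • gradU w n s.1
  let q := s.1 + ε • p'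
  (q, p' - (ε / 2) • gradU w n q)

/-- The HMC integrator `Ψ_n`: `L` leapfrog steps, followed by a momentum flip. -/
def integrator (w : Trace → ℝ) (ε : ℝ) (L n : ℕ) (s : (Fin n → ℝ) × (Fin n → ℝ)) :
    (Fin n → ℝ) × (Fin n → ℝ) :=
  (((leapfrog w ε n)^[L] s).1, - ((leapfrog w ε n)^[L] s).2)

/-- The space of states: the disjoint union of all `ℝⁿ × ℝⁿ`. -/
abbrev State : Type := Σ n : ℕ, (Fin n → ℝ) × (Fin n → ℝ)

/-- In the course of `L` leapfrog steps the particle never leaves the domain of `U_n`. -/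
def StaysInDomain (w : Trace → ℝ) (ε : ℝ) (L n : ℕ) (s : (Fin n → ℝ) × (Fin n → ℝ)) : Prop :=
  ∀ j ≤ L, 0 < trunc w n ((leapfrog w ε n)^[j] s).1

/-- The set of `(ε, L)`-valid states: the particle stays in the domain, and this holds for no
proper prefix of the state. -/
def Valid (w : Trace → ℝ) (ε : ℝ) (L : ℕ) : Set State :=
  {s | StaysInDomain w ε L s.1 s.2 ∧
    ∀ (k : ℕ) (hk : k < s.1), ¬ StaysInDomain w ε L k (pre s.2.1 hk.le, pre s.2.2 hk.le)}

open Classical in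
/-- The map `f` from states to traces: the (shortest) `w`-supported prefix of the position. The value
`[]`, for a position without such a prefix, is never used on a valid state. -/
def supported (w : Trace → ℝ) (s : State) : Trace :=
  if h : ∃ k, ∃ hk : k ≤ s.1, 0 < w ⟨k, pre s.2.1 hk⟩ then
    ⟨Nat.find h, pre s.2.1 (Nat.find_spec h).choose⟩
  else ⟨0, Fin.elim0⟩

/-- Initialisation and search: from a trace `q` of length `n`, the law of the state `(q ++ x, y)`
where `x` and `y` are standard normal of dimensions `m` and `n + m`, restricted to valid states and
summed over the number `m` of added coordinates. -/
def search (w : Trace → ℝ) (ε : ℝ) (L : ℕ) (q : Trace) : Measure State :=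
  Measure.sum fun m : ℕ =>
    (((stdNormal m).prod (stdNormal (q.1 + m))).map
      (fun z => (⟨q.1 + m, (Fin.append q.2 z.1, z.2)⟩ : State))).restrict (Valid w ε L)

/-- The density of the standard normal distribution of dimension `2 n` at `(q, p)`. -/
def normalDensity {n : ℕ} (s : (Fin n → ℝ) × (Fin n → ℝ)) : ℝ :=
  (∏ i, gaussianPDFReal 0 1 (s.1 i)) * ∏ i, gaussianPDFReal 0 1 (s.2 i)

/-- The Metropolis–Hastings acceptance probability. -/
def accept (w : Trace → ℝ) (ε : ℝ) (L : ℕ) (s : State) : ℝ :=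
  min 1 ((trunc w s.1 (integrator w ε L s.1 s.2).1 * normalDensity (integrator w ε L s.1 s.2)) /
    (trunc w s.1 s.2.1 * normalDensity s.2))

/-- Integration and acceptance: the transition kernel on valid states. -/
def integrateAccept (w : Trace → ℝ) (ε : ℝ) (L : ℕ) (s : State) : Measure State :=
  ENNReal.ofReal (accept w ε L s) • Measure.dirac (⟨s.1, integrator w ε L s.1 s.2⟩ : State) +
    ENNReal.ofReal (1 - accept w ε L s) • Measure.dirac s

open Classical in
/-- The transition kernel `P` of one step of NP-HMC on states (zero from states that are not valid). -/
def stateKernel (w : Trace → ℝ) (ε : ℝ) (L : ℕ) (s : State) (X : Set State) : ENNReal :=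
  if s ∈ Valid w ε L then
    ∫⁻ s', integrateAccept w ε L s' X ∂search w ε L (supported w s)
  else 0

open Classical in
/-- The transition kernel `Q` of the marginalised chain, on `w`-supported traces (and extended by
zero to all traces); it is determined by `Q (f s) B = P s (f⁻¹ B)` for valid states `s`, see
`marginalKernel_supported`. -/
def marginalKernel (w : Trace → ℝ) (ε : ℝ) (L : ℕ) (q : Trace) (B : Set Trace) : ENNReal :=
  if 0 < w q then
    ∫⁻ s', integrateAccept w ε L s' (supported w ⁻¹' B ∩ Valid w ε L) ∂search w ε L q
  else 0

theorem marginalKernel_supported (w : Trace → ℝ) (ε : ℝ) (L : ℕ) (s : State)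
    (hs : s ∈ Valid w ε L) (B : Set Trace) :
    marginalKernel w ε L (supported w s) B
      = stateKernel w ε L s (supported w ⁻¹' B ∩ Valid w ε L) := by
  have h0 : 0 < trunc w s.1 s.2.1 := hs.1 0 (Nat.zero_le _)
  have h : ∃ k, ∃ hk : k ≤ s.1, 0 < w ⟨k, pre s.2.1 hk⟩ := by
    by_contra hcon
    push Not at hcon
    exact absurd h0 (not_lt.2 (Finset.sum_nonpos fun k _ => hcon k _))
  have hpos : 0 < w (supported w s) := by
    classical
    unfold supported
    rw [dif_pos h]
    exact (Nat.find_spec h).choose_spec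
  rw [marginalKernel, stateKernel, if_pos hpos, if_pos hs]

/-! Assumptions -/

/-- `w` is a measurable, tree-representable density on traces that is integrable, almost everywhere
continuously differentiable, and positive on some finite prefix of almost every infinite
sequence (of independent standard normals). -/
structure StandingAssumptions (w : Trace → ℝ) : Prop where
  nonneg : ∀ t, 0 ≤ w t
  measurable : Measurable w
  tree : TreeRepresentable w
  integrable : Integrable w traceMeasure
  ae_contDiff : ∀ᵐ t ∂traceMeasure, ContDiffAt ℝ 1 (fun q : Fin t.1 → ℝ => w ⟨t.1, q⟩) t.2
  ae_prefix : ∀ᵐ x ∂Measure.infinitePi (fun _ : ℕ => gaussianReal 0 1),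
    ∃ k : ℕ, 0 < w ⟨k, fun i : Fin k => x i⟩

/-- The points of `A ∩ ℝⁿ` in the support of `w_{≤ n}` at which the gradient of `w_{≤ n}` exists. -/
def regularPoints (w : Trace → ℝ) (A : Set Trace) (n : ℕ) : Set (Fin n → ℝ) :=
  {q | (⟨n, q⟩ : Trace) ∈ A ∧ 0 < trunc w n q ∧ DifferentiableAt ℝ (trunc w n) q}

/-- The convergence conditions: continuous differentiability on a set `A` that carries the trace
measure and has a null boundary (C1), the lower bound for `w` on its support (C2), and the uniform
bounds (C3) and the Lipschitz continuity (C4) of `∇ w_{≤ n} / w_{≤ n}` on `supp w_{≤ n} ∩ A`. The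
bounds in (C3) hold for every coordinate and do not depend on `n`; the Lipschitz constant may. -/
structure ConvergenceAssumptions (w : Trace → ℝ) (A : Set Trace) : Prop where
  measurableSet : MeasurableSet A
  nonnull : traceMeasure A ≠ 0
  conull : traceMeasure Aᶜ = 0
  frontier_null : traceMeasure (frontier A) = 0
  differentiableAt : ∀ t ∈ A, DifferentiableAt ℝ (fun q : Fin t.1 → ℝ => w ⟨t.1, q⟩) t.2
  continuousOn_fderiv : ∀ n : ℕ,
    ContinuousOn (fderiv ℝ fun q : Fin n → ℝ => w ⟨n, q⟩) {q | (⟨n, q⟩ : Trace) ∈ A}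
  bounded_below : ∃ c : ℝ, 0 < c ∧ ∀ t, 0 < w t → c ≤ w t
  grad_bounded : ∃ M₁ M₂ : ℝ, ∀ (n : ℕ), ∀ q ∈ regularPoints w A n, ∀ i : Fin n,
    M₁ ≤ grad (trunc w n) q i / trunc w n q ∧ grad (trunc w n) q i / trunc w n q ≤ M₂
  grad_lipschitz : ∀ n : ℕ, ∃ K : NNReal, LipschitzOnWith K
    (fun (q : Fin n → ℝ) (i : Fin n) => grad (trunc w n) q i / trunc w n q) (regularPoints w A n)

/-! Aperiodicity -/

/-- A transition kernel `κ` is `ν`-aperiodic if there are no `d ≥ 1` and disjoint measurable sets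
`B 0, …, B d` with `ν (B 0) > 0` such that from every point of `B i` the chain moves to
`B (i + 1 mod d + 1)` with probability one. (Addition in `Fin (d + 1)` is modulo `d + 1`.) -/
def IsAperiodic {X : Type*} [MeasurableSpace X] (ν : Measure X) (κ : X → Set X → ENNReal) : Prop :=
  ¬ ∃ (d : ℕ) (B : Fin (d + 1) → Set X), 1 ≤ d ∧ (∀ i, MeasurableSet (B i)) ∧
    (∀ i j, i ≠ j → Disjoint (B i) (B j)) ∧ 0 < ν (B 0) ∧
    ∀ i, ∀ x ∈ B i, κ x (B (i + 1)) = 1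

end

end NPHMC

namespace NPHMC

noncomputable section

/-! Suppose the chain runs through a cycle. Since `d ≥ 1`, consecutive sets are disjoint, so from `B
0` the procedure almost surely terminates, accepts with probability one and ends in a valid state
above `B 1`; the same holds from `B 1` to the next set. The integrator `Ψ` is an involution and
preserves Lebesgue measure, so for almost every valid `s` above `B 0` certain acceptance at `s` and
at `Ψ s` gives two opposite inequalities: the joint density is conserved exactly (`ae_conserved`).
It remains to see that termination and exact conservation are incompatible (`not_ae_conserved`).

Conservation says that `log w_{≤N}` at the final position is a constant plus the gain of the
Gaussian energy `∑ (q² + p²) / 2`. This is tested on the lines `pivot`: the momentum of one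
coordinate changes by `a / ε` and its initial position by `-j a`, so that in free flight its
position `c` after `j` steps is fixed. By (C3) trajectories stay within a distance of free flight
that is bounded in `a`, and the gain has leading term `L (L - 2j) a² / 2`. If `2j < L` it grows
quadratically, whereas (C3) lets `log w_{≤N}` grow only linearly. If `L ≤ 2j` and `|c|` is large, a
linear term with coefficient close to `L c` drives the gain to `-∞` in one direction, which
contradicts (C2). See `not_ae_conserved_on_pivot`.

If almost no state above `B 0` leaves the domain, `j = 0` gives the contradiction. Otherwise let `j`
be the last step at which leaving has positive probability, in some dimension `m`. The search
appends coordinates, and coordinate `m` is in free flight up to step `j`. On the line through such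
an extension that pivots coordinate `m` at step `j`, earlier positions are in the domain because
their prefixes in dimension `m` are, the position at step `j` does not change, and later ones are in
the domain by maximality of `j`. So almost all of the line is valid, and coordinate `m` cannot be
far from the origin at step `j` (`ae_notMem_farStates`). The threshold does not depend on the final
dimension, and coordinate `m` is independent of leaving in dimension `m`, so it can be shifted
beyond the threshold: leaving is negligible after all (`measure_leavingStates_eq_zero`). -/

/-! ### Prefixes and truncations -/

/-- Taking prefixes, as a continuous linear map. -/
def preL {n k : ℕ} (h : k ≤ n) : (Fin n → ℝ) →L[ℝ] (Fin k → ℝ) :=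
  ContinuousLinearMap.pi fun i => ContinuousLinearMap.proj (Fin.castLE h i)

theorem pre_add {n k : ℕ} (h : k ≤ n) (q q' : Fin n → ℝ) :
    pre (q + q') h = pre q h + pre q' h := rfl

theorem pre_sub {n k : ℕ} (h : k ≤ n) (q q' : Fin n → ℝ) :
    pre (q - q') h = pre q h - pre q' h := rfl

theorem pre_smul {n k : ℕ} (h : k ≤ n) (c : ℝ) (q : Fin n → ℝ) :
    pre (c • q) h = c • pre q h := rfl

theorem pre_single_of_le {n k : ℕ} (h : k ≤ n) (i : Fin n) (hi : k ≤ i) (c : ℝ) :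
    pre (Pi.single i c : Fin n → ℝ) h = 0 := by
  funext l
  have : Fin.castLE h l ≠ i := by
    intro hl
    have := congrArg Fin.val hl
    simp at this
    omega
  simp [pre, this]

theorem pre_single_of_lt {n k : ℕ} (h : k ≤ n) (i : Fin n) (hi : (i : ℕ) < k) (c : ℝ) :
    pre (Pi.single i c : Fin n → ℝ) h = Pi.single ⟨i, hi⟩ c := by
  funext l
  simp only [pre, Pi.single_apply]
  congr 1
  simp [Fin.ext_iff]

theorem measurable_pre {n k : ℕ} (h : k ≤ n) : Measurable fun q : Fin n → ℝ => pre q h :=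
  (preL h).continuous.measurable

theorem continuous_pre {n k : ℕ} (h : k ≤ n) : Continuous fun q : Fin n → ℝ => pre q h :=
  (preL h).continuous

theorem trunc_pos_iff {w : Trace → ℝ} (h0 : ∀ t, 0 ≤ w t) {n : ℕ} {q : Fin n → ℝ} :
    0 < trunc w n q ↔ ∃ k, ∃ hk : k ≤ n, 0 < w ⟨k, pre q hk⟩ := by
  constructor
  · intro h
    by_contra hcon
    push Not at hcon
    exact absurd h (not_lt.2 (Finset.sum_nonpos fun k _ => hcon k _))
  · rintro ⟨k, hk, hw⟩
    exact Finset.sum_pos' (fun i _ => h0 _)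
      ⟨⟨k, Nat.lt_succ_of_le hk⟩, Finset.mem_univ _, hw⟩

theorem TreeRepresentable.eq_of_pos {w : Trace → ℝ} (ht : TreeRepresentable w) {n : ℕ}
    {q : Fin n → ℝ} {k l : ℕ} (hk : k ≤ n) (hl : l ≤ n) (h1 : 0 < w ⟨k, pre q hk⟩)
    (h2 : 0 < w ⟨l, pre q hl⟩) : k = l := by
  rcases lt_trichotomy k l with h | h | h
  · exact absurd h1 (ht l (pre q hl) h2 k h)
  · exact h
  · exact absurd h2 (ht k (pre q hk) h1 l h)

theorem trunc_eq_of_pos {w : Trace → ℝ} (h0 : ∀ t, 0 ≤ w t) (ht : TreeRepresentable w) {n k : ℕ}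
    {q : Fin n → ℝ} (hk : k ≤ n) (h : 0 < w ⟨k, pre q hk⟩) : trunc w n q = w ⟨k, pre q hk⟩ := by
  rw [trunc, Finset.sum_eq_single (⟨k, Nat.lt_succ_of_le hk⟩ : Fin (n + 1))]
  · intro l _ hl
    by_contra hne
    exact hl (Fin.ext (ht.eq_of_pos _ hk (lt_of_le_of_ne (h0 _) (Ne.symm hne)) h))
  · simp

/-- By tree representability the sum has only one nonzero term, and a prefix in the domain already
contains it. Coordinates beyond such a prefix therefore have no influence. -/
theorem trunc_pre_eq {w : Trace → ℝ} (h0 : ∀ t, 0 ≤ w t) (ht : TreeRepresentable w) {n k : ℕ}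
    {q : Fin n → ℝ} (hk : k ≤ n) (h : 0 < trunc w k (pre q hk)) :
    trunc w n q = trunc w k (pre q hk) := by
  obtain ⟨l, hl, hw⟩ := (trunc_pos_iff h0).1 h
  rw [trunc_eq_of_pos h0 ht hl hw, trunc_eq_of_pos h0 ht (hl.trans hk) hw]
  rfl

theorem trunc_pos_of_pre {w : Trace → ℝ} (h0 : ∀ t, 0 ≤ w t) {n k : ℕ}
    {q : Fin n → ℝ} (hk : k ≤ n) (h : 0 < trunc w k (pre q hk)) : 0 < trunc w n q := by
  obtain ⟨l, hl, hw⟩ := (trunc_pos_iff h0).1 h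
  exact (trunc_pos_iff h0).2 ⟨l, hl.trans hk, hw⟩

theorem not_trunc_pos_of_pos {w : Trace → ℝ} (h0 : ∀ t, 0 ≤ w t) (ht : TreeRepresentable w)
    {n k : ℕ} {q : Fin n → ℝ} (hw : 0 < w ⟨n, q⟩) (hk : k < n) :
    ¬ 0 < trunc w k (pre q hk.le) := by
  intro h
  obtain ⟨l, hl, hw'⟩ := (trunc_pos_iff h0).1 h
  exact ht n q hw l (hl.trans_lt hk) hw'

theorem le_trunc {w : Trace → ℝ} (h0 : ∀ t, 0 ≤ w t) (ht : TreeRepresentable w) {c : ℝ}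
    (hc : ∀ t, 0 < w t → c ≤ w t) {n : ℕ} {q : Fin n → ℝ} (h : 0 < trunc w n q) :
    c ≤ trunc w n q := by
  obtain ⟨l, hl, hw⟩ := (trunc_pos_iff h0).1 h
  rw [trunc_eq_of_pos h0 ht hl hw]
  exact hc _ hw

theorem measurable_sigmaMk {β : ℕ → Type*} [∀ n, MeasurableSpace (β n)] (n : ℕ) :
    Measurable (Sigma.mk n : β n → Σ n, β n) := by
  intro s hs
  exact (MeasurableSpace.measurableSet_iInf.1 hs) n

theorem measurableSet_sigma {β : ℕ → Type*} [∀ n, MeasurableSpace (β n)] {s : Set (Σ n, β n)}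
    (h : ∀ n, MeasurableSet (Sigma.mk n ⁻¹' s)) : MeasurableSet s :=
  MeasurableSpace.measurableSet_iInf.2 h

theorem measurable_trunc {w : Trace → ℝ} (hw : Measurable w) (n : ℕ) : Measurable (trunc w n) :=
  Finset.measurable_fun_sum _ fun k _ =>
    hw.comp ((measurable_sigmaMk (k : ℕ)).comp (measurable_pre _))

theorem measurable_gradU {w : Trace → ℝ} (hw : Measurable w) (n : ℕ) : Measurable (gradU w n) :=
  measurable_pi_lambda _ fun i =>
    ((measurable_fderiv_apply_const ℝ (trunc w n) (Pi.single i 1)).div (measurable_trunc hw n)).neg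

/-! ### Points all of whose prefixes lie in `A` -/

/-- The vectors all of whose prefixes lie in `A`. -/
def goodPoints (A : Set Trace) (n : ℕ) : Set (Fin n → ℝ) :=
  {q | ∀ (k : ℕ) (hk : k ≤ n), (⟨k, pre q hk⟩ : Trace) ∈ A}

theorem pre_mem_goodPoints {A : Set Trace} {n k : ℕ} {q : Fin n → ℝ} (hq : q ∈ goodPoints A n)
    (hk : k ≤ n) : pre q hk ∈ goodPoints A k := fun l hl => hq l (hl.trans hk)

theorem differentiableAt_trunc {w : Trace → ℝ} {A : Set Trace}
    (hd : ∀ t ∈ A, DifferentiableAt ℝ (fun q : Fin t.1 → ℝ => w ⟨t.1, q⟩) t.2) {n : ℕ}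
    {q : Fin n → ℝ} (hq : q ∈ goodPoints A n) : DifferentiableAt ℝ (trunc w n) q := by
  refine DifferentiableAt.fun_sum fun k _ => ?_
  exact (hd _ (hq k (Nat.le_of_lt_succ k.isLt))).comp (f := fun q => pre q _) q
    (preL (Nat.le_of_lt_succ k.isLt)).differentiableAt

theorem mem_regularPoints {w : Trace → ℝ} {A : Set Trace}
    (hd : ∀ t ∈ A, DifferentiableAt ℝ (fun q : Fin t.1 → ℝ => w ⟨t.1, q⟩) t.2) {n : ℕ}
    {q : Fin n → ℝ} (hq : q ∈ goodPoints A n) (h : 0 < trunc w n q) :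
    q ∈ regularPoints w A n :=
  ⟨hq n le_rfl, h, differentiableAt_trunc hd hq⟩

/-- Positivity of `w_{≤k}` persists near the prefix, so near `q` the function `w_{≤n}` is `w_{≤k}`
composed with the prefix map. Coordinates from `k` on feel no force. -/
theorem gradU_eq_of_pre {w : Trace → ℝ} (h0 : ∀ t, 0 ≤ w t) (ht : TreeRepresentable w)
    {n k : ℕ} (hk : k ≤ n) {q : Fin n → ℝ}
    (hd : DifferentiableAt ℝ (trunc w k) (pre q hk)) (h : 0 < trunc w k (pre q hk)) (i : Fin n) :
    gradU w n q i = if hi : (i : ℕ) < k then gradU w k (pre q hk) ⟨i, hi⟩ else 0 := by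
  have hev : trunc w n =ᶠ[nhds q] fun q => trunc w k (pre q hk) := by
    have hc : ContinuousAt (fun q => trunc w k (pre q hk)) q :=
      ContinuousAt.comp (f := fun q => pre q hk) hd.continuousAt (continuous_pre hk).continuousAt
    filter_upwards [hc.eventually_const_lt h] with q' hq'
    exact trunc_pre_eq h0 ht hk hq'
  have hf : fderiv ℝ (trunc w n) q = (fderiv ℝ (trunc w k) (pre q hk)).comp (preL hk) := by
    rw [hev.fderiv_eq]
    exact (hd.hasFDerivAt.comp (f := fun q => pre q hk) q (preL hk).hasFDerivAt).fderiv
  have hs : preL hk (Pi.single i 1) = pre (Pi.single i (1 : ℝ)) hk := rfl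
  simp only [gradU, grad, hf, ContinuousLinearMap.comp_apply, hs, trunc_pre_eq h0 ht hk h]
  split_ifs with hi
  · rw [pre_single_of_lt hk i hi]
  · rw [pre_single_of_le hk i (not_lt.1 hi)]
    simp

/-! ### Leapfrog dynamics for a general force -/

/-- Position and momentum in dimension `n`. -/
abbrev Phase (n : ℕ) : Type := (Fin n → ℝ) × (Fin n → ℝ)

/-- One leapfrog step for the force `-g`. -/
def leap {n : ℕ} (g : (Fin n → ℝ) → Fin n → ℝ) (ε : ℝ) (s : Phase n) : Phase n :=
  (s.1 + ε • (s.2 - (ε / 2) • g s.1),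
    s.2 - (ε / 2) • g s.1 - (ε / 2) • g (s.1 + ε • (s.2 - (ε / 2) • g s.1)))

theorem leapfrog_eq (w : Trace → ℝ) (ε : ℝ) (n : ℕ) : leapfrog w ε n = leap (gradU w n) ε := rfl

theorem leap_fst {n : ℕ} (g : (Fin n → ℝ) → Fin n → ℝ) (ε : ℝ) (s : Phase n) :
    (leap g ε s).1 = s.1 + ε • (s.2 - (ε / 2) • g s.1) := rfl

theorem leap_snd {n : ℕ} (g : (Fin n → ℝ) → Fin n → ℝ) (ε : ℝ) (s : Phase n) :
    (leap g ε s).2 = s.2 - (ε / 2) • g s.1 - (ε / 2) • g (leap g ε s).1 := rfl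

/-- Reversal of the momentum. -/
def flip {n : ℕ} (s : Phase n) : Phase n := (s.1, -s.2)

theorem flip_flip {n : ℕ} (s : Phase n) : flip (flip s) = s := by simp [flip]

/-- Time reversibility: the step is a half kick, a drift and a half kick, hence symmetric, and
flipping the momentum runs it backwards. No property of `g` is needed. -/
theorem leap_flip_leap {n : ℕ} (g : (Fin n → ℝ) → Fin n → ℝ) (ε : ℝ) (s : Phase n) :
    leap g ε (flip (leap g ε s)) = flip s := by
  have h1 : (leap g ε (flip (leap g ε s))).1 = s.1 := by
    rw [leap_fst]
    simp only [flip]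
    rw [leap_snd, leap_fst]
    module
  refine Prod.ext h1 ?_
  rw [leap_snd, h1]
  simp only [flip]
  rw [leap_snd]
  module

theorem leap_iterate_flip {n : ℕ} (g : (Fin n → ℝ) → Fin n → ℝ) (ε : ℝ) (L : ℕ) (s : Phase n) :
    (leap g ε)^[L] (flip ((leap g ε)^[L] s)) = flip s := by
  induction L with
  | zero => rfl
  | succ L ih =>
    rw [Function.iterate_succ_apply, Function.iterate_succ_apply' (leap g ε) L s, leap_flip_leap, ih]

theorem integrator_eq (w : Trace → ℝ) (ε : ℝ) (L n : ℕ) (s : Phase n) :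
    integrator w ε L n s = flip ((leapfrog w ε n)^[L] s) := rfl

theorem integrator_integrator (w : Trace → ℝ) (ε : ℝ) (L n : ℕ) (s : Phase n) :
    integrator w ε L n (integrator w ε L n s) = s := by
  rw [integrator_eq, integrator_eq, leapfrog_eq, leap_iterate_flip, flip_flip]

/-- Comparison with free flight: each step changes a momentum by at most `ε M`, and these errors
accumulate in the position. The constants are crude; what matters is that they depend neither on the
initial state nor on the dimension. -/
theorem leap_iterate_bound {n : ℕ} {g : (Fin n → ℝ) → Fin n → ℝ} {M ε : ℝ} (hε : 0 < ε)
    (hg : ∀ x i, |g x i| ≤ M) (i : Fin n) (s : Phase n) (l : ℕ) :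
    |((leap g ε)^[l] s).2 i - s.2 i| ≤ l * (ε * M) ∧
      |((leap g ε)^[l] s).1 i - (s.1 i + l * ε * s.2 i)| ≤ l * (l + 1) * (ε * ε * M) := by
  induction l with
  | zero => simp
  | succ l ih =>
    obtain ⟨ih2, ih1⟩ := ih
    rw [Function.iterate_succ_apply']
    set t := (leap g ε)^[l] s
    have e1 : (leap g ε t).1 i = t.1 i + ε * (t.2 i - ε / 2 * g t.1 i) := by
      simp [leap_fst]
    have e2 : (leap g ε t).2 i = t.2 i - ε / 2 * g t.1 i - ε / 2 * g (leap g ε t).1 i := by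
      rw [leap_snd]; simp
    have b1 := hg t.1 i
    have b2 := hg (leap g ε t).1 i
    have hM : 0 ≤ M := (abs_nonneg _).trans b1
    have c1 : |ε / 2 * g t.1 i| ≤ ε / 2 * M := by
      rw [abs_mul, abs_of_pos (by positivity : 0 < ε / 2)]; gcongr
    have c2 : |ε / 2 * g (leap g ε t).1 i| ≤ ε / 2 * M := by
      rw [abs_mul, abs_of_pos (by positivity : 0 < ε / 2)]; gcongr
    constructor
    · rw [e2]
      rw [abs_le] at *
      push_cast
      constructor <;> nlinarith
    · rw [e1]
      have d : |ε * (t.2 i - s.2 i)| ≤ ε * (l * (ε * M)) := by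
        rw [abs_mul, abs_of_pos hε]; gcongr
      have d' : |ε * (ε / 2 * g t.1 i)| ≤ ε * (ε / 2 * M) := by
        rw [abs_mul, abs_of_pos hε]; gcongr
      have hl : (0 : ℝ) ≤ l := Nat.cast_nonneg l
      have hp : 0 ≤ ε * ε * M := by positivity
      have hlp : 0 ≤ l * (ε * ε * M) := by positivity
      rw [abs_le] at *
      push_cast
      constructor <;> nlinarith

/-- Allows the true force, which is controlled only at regular points, to be replaced by a globally
bounded Lipschitz one along trajectories that visit only regular points. -/
theorem leap_iterate_congr {n : ℕ} {g g' : (Fin n → ℝ) → Fin n → ℝ} {ε : ℝ} {S : Set (Fin n → ℝ)}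
    (hg : ∀ x ∈ S, g x = g' x) {s : Phase n} {L : ℕ} (hs : ∀ l ≤ L, ((leap g ε)^[l] s).1 ∈ S) :
    ∀ l ≤ L, (leap g' ε)^[l] s = (leap g ε)^[l] s := by
  intro l
  induction l with
  | zero => intro _; rfl
  | succ l ih =>
    intro hl
    rw [Function.iterate_succ_apply', ih (by omega)]
    have h1 := hg _ (hs l (by omega))
    have h2 := hs (l + 1) hl
    rw [Function.iterate_succ_apply'] at h2 ⊢
    have h3 : (leap g' ε ((leap g ε)^[l] s)).1 = (leap g ε ((leap g ε)^[l] s)).1 := by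
      rw [leap_fst, leap_fst, h1]
    refine Prod.ext h3 ?_
    rw [leap_snd, leap_snd, h3, h1, hg _ h2]

theorem exists_lipschitzWith_leap {n : ℕ} {g : (Fin n → ℝ) → Fin n → ℝ} {K : NNReal}
    (hg : LipschitzWith K g) (ε : ℝ) (L : ℕ) :
    ∃ K' : NNReal, LipschitzWith K' ((leap g ε)^[L]) := by
  have h1 : LipschitzWith _ fun s : Phase n => s.2 - (ε / 2) • g s.1 :=
    LipschitzWith.prod_snd.sub ((lipschitzWith_smul (ε / 2)).comp (hg.comp LipschitzWith.prod_fst))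
  have h2 : LipschitzWith _ fun s : Phase n => s.1 + ε • (s.2 - (ε / 2) • g s.1) :=
    LipschitzWith.prod_fst.add ((lipschitzWith_smul ε).comp h1)
  have h3 := h2.prodMk (h1.sub ((lipschitzWith_smul (ε / 2)).comp (hg.comp h2)))
  exact ⟨_, h3.iterate L⟩

/-! ### The leapfrog dynamics in different dimensions -/

/-- The prefix of length `k` of a state. -/
def preS {n k : ℕ} (s : Phase n) (h : k ≤ n) : Phase k := (pre s.1 h, pre s.2 h)

/-- The states whose positions after at most `L` leapfrog steps have all their prefixes in `A`. -/
def goodStates (w : Trace → ℝ) (A : Set Trace) (ε : ℝ) (L n : ℕ) : Set (Phase n) :=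
  {s | ∀ l ≤ L, ((leapfrog w ε n)^[l] s).1 ∈ goodPoints A n}

/-- As long as the particle stays in the domain in dimension `k`, its coordinates below `k` move in
the same way in dimension `n`. -/
theorem pre_leapfrog_iterate {w : Trace → ℝ} {A : Set Trace} (h0 : ∀ t, 0 ≤ w t)
    (ht : TreeRepresentable w)
    (hd : ∀ t ∈ A, DifferentiableAt ℝ (fun q : Fin t.1 → ℝ => w ⟨t.1, q⟩) t.2)
    {ε : ℝ} {L n k j : ℕ} (hk : k ≤ n) (hj : j ≤ L) {s : Phase n}
    (hs : s ∈ goodStates w A ε L n)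
    (h : ∀ l < j, 0 < trunc w k ((leapfrog w ε k)^[l] (preS s hk)).1) :
    ∀ l ≤ j, pre ((leapfrog w ε n)^[l] s).1 hk = ((leapfrog w ε k)^[l] (preS s hk)).1 ∧
      (0 < trunc w k ((leapfrog w ε k)^[l] (preS s hk)).1 →
        pre ((leapfrog w ε n)^[l] s).2 hk = ((leapfrog w ε k)^[l] (preS s hk)).2) := by
  have key : ∀ q ∈ goodPoints A n, 0 < trunc w k (pre q hk) →
      pre (gradU w n q) hk = gradU w k (pre q hk) := by
    intro q hq hpos
    funext i
    have := gradU_eq_of_pre h0 ht hk (differentiableAt_trunc hd (pre_mem_goodPoints hq hk)) hpos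
      (Fin.castLE hk i)
    simpa [pre] using this
  intro l
  induction l with
  | zero => intro _; exact ⟨rfl, fun _ => rfl⟩
  | succ l ih =>
    intro hl
    obtain ⟨ih1, ih2⟩ := ih (by omega)
    have hpos := h l (by omega)
    have ih2' := ih2 hpos
    have hg1 := hs l (by omega)
    have hg2 := hs (l + 1) (by omega)
    simp only [Function.iterate_succ_apply'] at hg2 ⊢
    set t := (leapfrog w ε n)^[l] s
    set t' := (leapfrog w ε k)^[l] (preS s hk)
    rw [← ih1] at hpos
    have kq := key t.1 hg1 hpos
    rw [leapfrog_eq, leapfrog_eq] at *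
    have e1 : pre (leap (gradU w n) ε t).1 hk = (leap (gradU w k) ε t').1 := by
      rw [leap_fst, leap_fst, pre_add, pre_smul, pre_sub, pre_smul, kq, ih1, ih2']
    -- The closing half kick uses the force at the new position, so the momenta are only known to
    -- agree if that position is in the domain as well.
    refine ⟨e1, fun hpos' => ?_⟩
    rw [← e1] at hpos'
    rw [leap_snd, leap_snd, pre_sub, pre_sub, pre_smul, pre_smul, kq, ih1, ih2',
      key _ hg2 hpos', e1]

/-- As long as the particle stays in the domain in dimension `k`, a coordinate `i ≥ k` is in free
flight and does not influence the other coordinates. -/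
theorem leapfrog_iterate_shear {w : Trace → ℝ} {A : Set Trace} (h0 : ∀ t, 0 ≤ w t)
    (ht : TreeRepresentable w)
    (hd : ∀ t ∈ A, DifferentiableAt ℝ (fun q : Fin t.1 → ℝ => w ⟨t.1, q⟩) t.2)
    {ε : ℝ} {L n k j : ℕ} (hk : k ≤ n) (hj : j ≤ L) {s s' : Phase n}
    (hs : s ∈ goodStates w A ε L n) (hs' : s' ∈ goodStates w A ε L n) {i : Fin n} (hi : k ≤ i)
    {α β : ℝ} (h1 : s'.1 = s.1 + Pi.single i α) (h2 : s'.2 = s.2 + Pi.single i β)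
    (h : ∀ l < j, 0 < trunc w k (pre ((leapfrog w ε n)^[l] s).1 hk)) :
    ∀ l ≤ j, ((leapfrog w ε n)^[l] s').1 =
        ((leapfrog w ε n)^[l] s).1 + Pi.single i (α + l * ε * β) ∧
      (0 < trunc w k (pre ((leapfrog w ε n)^[l] s).1 hk) →
        ((leapfrog w ε n)^[l] s').2 = ((leapfrog w ε n)^[l] s).2 + Pi.single i β) := by
  have key : ∀ q ∈ goodPoints A n, ∀ q' ∈ goodPoints A n, ∀ c : ℝ, q' = q + Pi.single i c →
      0 < trunc w k (pre q hk) → gradU w n q' = gradU w n q := by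
    intro q hq q' hq' c hc hpos
    have hp : pre q' hk = pre q hk := by
      rw [hc, pre_add, pre_single_of_le hk i hi, add_zero]
    funext u
    rw [gradU_eq_of_pre h0 ht hk (differentiableAt_trunc hd (pre_mem_goodPoints hq hk)) hpos,
      gradU_eq_of_pre h0 ht hk (differentiableAt_trunc hd (pre_mem_goodPoints hq' hk))
        (hp ▸ hpos), hp]
  have sing : ∀ a b : ℝ, (Pi.single i (a + ε * b) : Fin n → ℝ) =
      Pi.single i a + ε • Pi.single i b := by
    intro a b
    rw [← Pi.single_smul, ← Pi.single_add, smul_eq_mul]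
  intro l
  induction l with
  | zero => intro _; exact ⟨by simpa using h1, fun _ => h2⟩
  | succ l ih =>
    intro hl
    obtain ⟨ih1, ih2⟩ := ih (by omega)
    have hpos := h l (by omega)
    have ih2' := ih2 hpos
    have hg1 := hs l (by omega)
    have hg2 := hs (l + 1) (by omega)
    have hg1' := hs' l (by omega)
    have hg2' := hs' (l + 1) (by omega)
    simp only [Function.iterate_succ_apply'] at hg2 hg2' ⊢
    set t := (leapfrog w ε n)^[l] s
    set t' := (leapfrog w ε n)^[l] s'
    have kq := key t.1 hg1 t'.1 hg1' _ ih1 hpos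
    rw [leapfrog_eq] at *
    have e1 : (leap (gradU w n) ε t').1 =
        (leap (gradU w n) ε t).1 + Pi.single i (α + (l + 1 : ℕ) * ε * β) := by
      have : α + (l + 1 : ℕ) * ε * β = (α + l * ε * β) + ε * β := by push_cast; ring
      rw [leap_fst, leap_fst, kq, ih1, ih2', this, sing]
      module
    refine ⟨e1, fun hpos' => ?_⟩
    rw [leap_snd, leap_snd, kq, ih2', key _ hg2 _ hg2' _ e1 hpos']
    module

/-! ### The Gaussian energy -/

/-- The energy of a state for the standard normal distribution on phase space. -/
def energy {n : ℕ} (s : Phase n) : ℝ := ∑ u, (s.1 u ^ 2 + s.2 u ^ 2) / 2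

theorem normalDensity_eq {n : ℕ} (s : Phase n) :
    normalDensity s = ((Real.sqrt (2 * Real.pi))⁻¹ ^ n * (Real.sqrt (2 * Real.pi))⁻¹ ^ n) *
      Real.exp (-energy s) := by
  have h : ∀ x : Fin n → ℝ, ∏ i, gaussianPDFReal 0 1 (x i) =
      (Real.sqrt (2 * Real.pi))⁻¹ ^ n * Real.exp (∑ i, -(x i) ^ 2 / 2) := by
    intro x
    simp [gaussianPDFReal, Finset.prod_mul_distrib, Real.exp_sum]
  rw [normalDensity, h, h, energy, mul_mul_mul_comm, ← Real.exp_add, ← Finset.sum_add_distrib,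
    ← Finset.sum_neg_distrib]
  congr 3
  funext i
  ring

theorem normalDensity_pos {n : ℕ} (s : Phase n) : 0 < normalDensity s := by
  rw [normalDensity_eq]; positivity

theorem energy_flip {n : ℕ} (s : Phase n) : energy (flip s) = energy s := by
  simp [energy, flip]

theorem contDiff_energy {n : ℕ} : ContDiff ℝ 1 (energy : Phase n → ℝ) := by
  unfold energy
  fun_prop

/-! ### Linear growth of functions of bounded slope -/

/-- The slope bound is a closed condition on `b` and `S` is dense, so near a point of `S` it extends
to all `b` and bounds the derivative. A locally Lipschitz function is absolutely continuous on
intervals, so the almost everywhere bound on the derivative can be integrated. -/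
theorem abs_sub_le_of_ae_slope {Φ : ℝ → ℝ} (hΦ : LocallyLipschitz Φ) {C : ℝ} (hC : 0 ≤ C)
    {S : Set ℝ} (hS : ∀ᵐ a, a ∈ S)
    (h : ∀ a ∈ S, ∀ᶠ b in nhds a, b ∈ S → |Φ b - Φ a| ≤ C * |b - a|) (a b : ℝ) :
    |Φ b - Φ a| ≤ C * |b - a| := by
  have hd : ∀ᵐ x, ‖deriv Φ x‖ ≤ C := by
    filter_upwards [hS] with x hx
    refine norm_deriv_le_of_lip' hC ?_
    obtain ⟨U, hU, hUo, hxU⟩ := eventually_nhds_iff.1 (h x hx)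
    have hcl : IsClosed {y | |Φ y - Φ x| ≤ C * |y - x|} :=
      isClosed_le (by have := hΦ.continuous; fun_prop) (by fun_prop)
    have hsub : U ⊆ {y | |Φ y - Φ x| ≤ C * |y - x|} := by
      refine ((Measure.dense_of_ae hS).open_subset_closure_inter hUo).trans ?_
      refine closure_minimal ?_ hcl
      rintro y ⟨hy, hyS⟩
      exact hU y hy hyS
    filter_upwards [hUo.mem_nhds hxU] with y hy
    exact hsub hy
  obtain ⟨K, hK⟩ := (hΦ.locallyLipschitzOn (s := Set.uIcc a b)).exists_lipschitzOnWith_of_compact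
    isCompact_uIcc
  rw [← hK.absolutelyContinuousOnInterval.integral_deriv_eq_sub]
  have := intervalIntegral.norm_integral_le_of_norm_le_const_ae (a := a) (b := b) (C := C)
    (f := deriv Φ) (hd.mono fun x hx _ => hx)
  simpa using this

theorem abs_fderiv_le_of_partial {n : ℕ} (f : (Fin n → ℝ) →L[ℝ] ℝ) {M : ℝ}
    (h : ∀ i, |f (Pi.single i 1)| ≤ M) (v : Fin n → ℝ) : |f v| ≤ n * M * ‖v‖ := by
  have e : f v = ∑ i, v i * f (Pi.single i 1) := by
    have := (f : (Fin n → ℝ) →ₗ[ℝ] ℝ).pi_apply_eq_sum_univ v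
    simp only [ContinuousLinearMap.coe_coe, smul_eq_mul] at this
    rw [this]
    refine Finset.sum_congr rfl fun i _ => ?_
    congr 2
    funext j
    simp [Pi.single_apply, eq_comm]
  rw [e]
  calc |∑ i, v i * f (Pi.single i 1)| ≤ ∑ i, |v i * f (Pi.single i 1)| :=
        Finset.abs_sum_le_sum_abs _ _
    _ ≤ ∑ _i : Fin n, ‖v‖ * M := by
        refine Finset.sum_le_sum fun i _ => ?_
        rw [abs_mul]
        exact mul_le_mul (norm_le_pi_norm v i) (h i) (abs_nonneg _) (norm_nonneg _)
    _ = n * M * ‖v‖ := by simp; ring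

/-! ### A bounded Lipschitz force on the whole space -/

/-- In the sup norm each component extends separately with the same Lipschitz constant; clipping to
`[-M, M]` is 1-Lipschitz and changes nothing on `S`. -/
theorem exists_bounded_lipschitz_extension {n : ℕ} {g : (Fin n → ℝ) → Fin n → ℝ}
    {S : Set (Fin n → ℝ)} {M : ℝ} {K : NNReal} (hM0 : 0 ≤ M) (hg : LipschitzOnWith K g S)
    (hM : ∀ q ∈ S, ∀ i, |g q i| ≤ M) :
    ∃ G : (Fin n → ℝ) → Fin n → ℝ, LipschitzWith K G ∧ (∀ q i, |G q i| ≤ M) ∧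
      ∀ q ∈ S, g q = G q := by
  obtain ⟨G, hG, hGS⟩ := hg.extend_pi
  refine ⟨fun q i => max (-M) (min M (G q i)), ?_, ?_, ?_⟩
  · refine LipschitzWith.of_dist_le_mul fun x y => ?_
    refine (dist_pi_le_iff (mul_nonneg K.2 dist_nonneg)).2 fun i => ?_
    have h1 : LipschitzWith K fun q => G q i := by
      refine LipschitzWith.of_dist_le_mul fun x y => ?_
      exact (dist_le_pi_dist _ _ i).trans (hG.dist_le_mul x y)
    exact ((h1.const_min M).const_max (-M)).dist_le_mul x y
  · intro q i
    rw [abs_le]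
    exact ⟨le_max_left _ _, max_le (by linarith) (min_le_left _ _)⟩
  · intro q hq
    funext i
    have := abs_le.1 (hM q hq i)
    show g q i = max (-M) (min M (G q i))
    rw [← hGS hq, min_eq_right this.2, max_eq_right this.1]

/-! ### Conservation of the energy along a line of states -/

/-- The state `s`, with the velocity of the coordinate `i` changed by `a / ε` in such a way that in
free flight its position after `j` leapfrog steps is the same. -/
def pivot {n : ℕ} (ε : ℝ) (j : ℕ) (i : Fin n) (s : Phase n) (a : ℝ) : Phase n :=
  (s.1 + Pi.single i (-(j * a)), s.2 + Pi.single i (a / ε))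

theorem pivot_fst_of_ne {n : ℕ} (ε : ℝ) (j : ℕ) {i u : Fin n} (hu : u ≠ i) (s : Phase n) (a : ℝ) :
    (pivot ε j i s a).1 u = s.1 u := by simp [pivot, hu]

theorem pivot_snd_of_ne {n : ℕ} (ε : ℝ) (j : ℕ) {i u : Fin n} (hu : u ≠ i) (s : Phase n) (a : ℝ) :
    (pivot ε j i s a).2 u = s.2 u := by simp [pivot, hu]

theorem pivot_fst_self {n : ℕ} (ε : ℝ) (j : ℕ) (i : Fin n) (s : Phase n) (a : ℝ) :
    (pivot ε j i s a).1 i = s.1 i - j * a := by simp [pivot, sub_eq_add_neg]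

theorem pivot_snd_self {n : ℕ} (ε : ℝ) (j : ℕ) (i : Fin n) (s : Phase n) (a : ℝ) :
    (pivot ε j i s a).2 i = s.2 i + a / ε := by simp [pivot]

/-- The energy gained by the other coordinates is bounded along the line. -/
theorem exists_bound_energy_rest {n : ℕ} {g : (Fin n → ℝ) → Fin n → ℝ} {M ε : ℝ} (hε : 0 < ε)
    (hg : ∀ x i, |g x i| ≤ M) (L j : ℕ) (i : Fin n) (s : Phase n) :
    ∃ B : ℝ, ∀ a, |(energy ((leap g ε)^[L] (pivot ε j i s a)) - energy (pivot ε j i s a)) -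
      ((((leap g ε)^[L] (pivot ε j i s a)).1 i ^ 2 + ((leap g ε)^[L] (pivot ε j i s a)).2 i ^ 2) / 2
        - ((pivot ε j i s a).1 i ^ 2 + (pivot ε j i s a).2 i ^ 2) / 2)| ≤ B := by
  have hu : ∀ u, ∃ B : ℝ, u ≠ i → ∀ a,
      |(((leap g ε)^[L] (pivot ε j i s a)).1 u ^ 2 + ((leap g ε)^[L] (pivot ε j i s a)).2 u ^ 2) / 2
        - ((pivot ε j i s a).1 u ^ 2 + (pivot ε j i s a).2 u ^ 2) / 2| ≤ B := by
    intro u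
    -- Coordinates other than `i` start from values independent of `a`, and their deviation from
    -- free flight is bounded independently of `a`.
    refine ⟨(L * (L + 1) * (ε * ε * M) + |s.1 u + L * ε * s.2 u|) ^ 2 + (L * (ε * M) + |s.2 u|) ^ 2
      + (s.1 u ^ 2 + s.2 u ^ 2), fun hne a => ?_⟩
    obtain ⟨h2, h1⟩ := leap_iterate_bound hε hg u (pivot ε j i s a) L
    rw [pivot_snd_of_ne ε j hne] at *
    rw [pivot_fst_of_ne ε j hne] at *
    set x := ((leap g ε)^[L] (pivot ε j i s a)).1 u
    set y := ((leap g ε)^[L] (pivot ε j i s a)).2 u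
    have hx : |x| ≤ L * (L + 1) * (ε * ε * M) + |s.1 u + L * ε * s.2 u| := by
      have := abs_add_le (x - (s.1 u + L * ε * s.2 u)) (s.1 u + L * ε * s.2 u)
      rw [sub_add_cancel] at this
      linarith
    have hy : |y| ≤ L * (ε * M) + |s.2 u| := by
      have := abs_add_le (y - s.2 u) (s.2 u)
      rw [sub_add_cancel] at this
      linarith
    have hx2 := pow_le_pow_left₀ (abs_nonneg x) hx 2
    have hy2 := pow_le_pow_left₀ (abs_nonneg y) hy 2
    rw [sq_abs] at hx2 hy2
    rw [abs_le]
    constructor <;> nlinarith [sq_nonneg x, sq_nonneg y, sq_nonneg (s.1 u), sq_nonneg (s.2 u)]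
  choose B hB using hu
  refine ⟨∑ u ∈ Finset.univ.erase i, B u, fun a => ?_⟩
  rw [energy, energy, ← Finset.sum_sub_distrib, ← Finset.add_sum_erase _ _ (Finset.mem_univ i),
    add_sub_cancel_left]
  refine (Finset.abs_sum_le_sum_abs _ _).trans (Finset.sum_le_sum fun u hu => ?_)
  exact hB u (Finset.ne_of_mem_erase hu) a

/-- The energy gained by the coordinate `i`. -/
theorem exists_energy_coord {n : ℕ} {g : (Fin n → ℝ) → Fin n → ℝ} {M ε : ℝ} (hε : 0 < ε)
    (hg : ∀ x i, |g x i| ≤ M) (L j : ℕ) (i : Fin n) (s : Phase n) (a : ℝ) :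
    ∃ r ρ : ℝ, |r| ≤ L * (L + 1) * (ε * ε * M) ∧ |ρ| ≤ L * M ∧
      (((leap g ε)^[L] (pivot ε j i s a)).1 i ^ 2 + ((leap g ε)^[L] (pivot ε j i s a)).2 i ^ 2) / 2
        - ((pivot ε j i s a).1 i ^ 2 + (pivot ε j i s a).2 i ^ 2) / 2 =
      L * (L - 2 * j) * (a + ε * s.2 i) ^ 2 / 2
        + (a + ε * s.2 i) * (L * (s.1 i + j * ε * s.2 i) + (L - j) * r + ρ)
        + ((s.1 i + j * ε * s.2 i + r) ^ 2 + (ε * ρ) ^ 2 - (s.1 i + j * ε * s.2 i) ^ 2) / 2 := by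
  obtain ⟨h2, h1⟩ := leap_iterate_bound hε hg i (pivot ε j i s a) L
  refine ⟨_, (((leap g ε)^[L] (pivot ε j i s a)).2 i - (pivot ε j i s a).2 i) / ε, h1, ?_, ?_⟩
  · rw [abs_div, abs_of_pos hε, div_le_iff₀ hε]
    linarith
  · rw [pivot_fst_self, pivot_snd_self]
    field_simp
    ring

theorem pivot_eq_add_smul {n : ℕ} (ε : ℝ) (j : ℕ) (i : Fin n) (s : Phase n) (a : ℝ) :
    pivot ε j i s a = s + a • ((Pi.single i (-(j : ℝ)), Pi.single i ε⁻¹) : Phase n) := by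
  refine Prod.ext ?_ ?_
  · simp [pivot, ← Pi.single_smul, mul_comm]
  · simp [pivot, ← Pi.single_smul, div_eq_mul_inv]

theorem exists_lipschitzWith_pivot {n : ℕ} (ε : ℝ) (j : ℕ) (i : Fin n) (s : Phase n) :
    ∃ K : NNReal, LipschitzWith K (pivot ε j i s) := by
  refine ⟨‖((Pi.single i (-(j : ℝ)), Pi.single i ε⁻¹) : Phase n)‖₊,
    LipschitzWith.of_dist_le_mul fun a b => ?_⟩
  rw [pivot_eq_add_smul, pivot_eq_add_smul, dist_add_left, dist_eq_norm, ← sub_smul, norm_smul,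
    mul_comm, coe_nnnorm, ← dist_eq_norm]

theorem locallyLipschitz_energy_sub {n : ℕ} {f g : ℝ → Phase n} (hf : LocallyLipschitz f)
    (hg : LocallyLipschitz g) : LocallyLipschitz fun a => energy (f a) - energy (g a) := by
  have h1 : LocallyLipschitz (energy : Phase n → ℝ) := contDiff_energy.locallyLipschitz
  have h2 : LocallyLipschitz fun p : ℝ × ℝ => p.1 - p.2 := by
    have : ContDiff ℝ 1 fun p : ℝ × ℝ => p.1 - p.2 := by fun_prop
    exact this.locallyLipschitz
  exact h2.comp ((h1.comp hf).prodMk (h1.comp hg))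

/-- Near a regular point, the slope of `log w_{≤ n}` is bounded. -/
theorem eventually_abs_log_trunc_sub_le {w : Trace → ℝ} {n : ℕ} {q : Fin n → ℝ} {M : ℝ}
    (hd : DifferentiableAt ℝ (trunc w n) q) (hpos : 0 < trunc w n q)
    (hM : ∀ i, |gradU w n q i| ≤ M) :
    ∀ᶠ q' in nhds q, |Real.log (trunc w n q') - Real.log (trunc w n q)| ≤
      (n * M + 1) * ‖q' - q‖ := by
  have h := hd.hasFDerivAt.log hpos.ne'
  filter_upwards [h.isLittleO.def zero_lt_one] with q' hq'
  have h1 := abs_fderiv_le_of_partial ((trunc w n q)⁻¹ • fderiv ℝ (trunc w n) q) (M := M)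
    (fun i => by
      have := hM i
      rw [gradU, abs_neg] at this
      simpa [grad, div_eq_inv_mul] using this) (q' - q)
  have h2 := abs_add_le (Real.log (trunc w n q') - Real.log (trunc w n q) -
    ((trunc w n q)⁻¹ • fderiv ℝ (trunc w n) q) (q' - q))
    (((trunc w n q)⁻¹ • fderiv ℝ (trunc w n) q) (q' - q))
  rw [sub_add_cancel] at h2
  rw [Real.norm_eq_abs, one_mul] at hq'
  linarith

/-- Upper bound for the energy gained along a line, when the pivot is late. -/
theorem exists_energy_gain_le {n : ℕ} {G : (Fin n → ℝ) → Fin n → ℝ} {M ε : ℝ} (hε : 0 < ε)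
    (hM0 : 0 ≤ M) (hGM : ∀ x i, |G x i| ≤ M) {L j : ℕ} (hL : 1 ≤ L) (hj : j ≤ L) (i : Fin n)
    (s : Phase n) (hLj : L ≤ 2 * j)
    (hfar : L * (L + 1) * (ε * ε * M) + L * M + 1 < |s.1 i + j * ε * s.2 i|) :
    ∃ P : ℝ, ∀ a, 0 ≤ -SignType.sign (s.1 i + j * ε * s.2 i) * (a + ε * s.2 i) →
      energy ((leap G ε)^[L] (pivot ε j i s a)) - energy (pivot ε j i s a) ≤
        SignType.sign (s.1 i + j * ε * s.2 i) * (a + ε * s.2 i) + P := by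
  obtain ⟨B, hB⟩ := exists_bound_energy_rest hε hGM L j i s
  have hB0 : 0 ≤ B := (abs_nonneg _).trans (hB 0)
  have hL1 : (1 : ℝ) ≤ L := by exact_mod_cast hL
  have hj1 : (j : ℝ) ≤ L := by exact_mod_cast hj
  have hj0 : (0 : ℝ) ≤ j := Nat.cast_nonneg j
  have hD10 : 0 ≤ L * (L + 1) * (ε * ε * M) := by positivity
  have hD20 : 0 ≤ L * M := by positivity
  have hcoord := exists_energy_coord hε hGM L j i s
  generalize hcdef : s.1 i + j * ε * s.2 i = c at *
  generalize hD1 : L * (L + 1) * (ε * ε * M) = D1 at *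
  generalize hD2 : L * M = D2 at *
  have hLj' : (L : ℝ) ≤ 2 * j := by exact_mod_cast hLj
  refine ⟨((|c| + D1) ^ 2 + (ε * D2) ^ 2) / 2 + B, fun a ha => ?_⟩
  obtain ⟨r, ρ, hr, hρ, e⟩ := hcoord a
  have hBa := hB a
  rw [e] at hBa
  have hBa' := (abs_le.1 hBa).2
  have hquad : L * (L - 2 * j) * (a + ε * s.2 i) ^ 2 / 2 ≤ 0 := by
    have : L * (L - 2 * (j : ℝ)) ≤ 0 := mul_nonpos_of_nonneg_of_nonpos (by linarith) (by linarith)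
    have := mul_nonpos_of_nonpos_of_nonneg this (sq_nonneg (a + ε * s.2 i))
    linarith
  have hcr : (c + r) ^ 2 ≤ (|c| + D1) ^ 2 := by
    rw [← sq_abs]
    exact pow_le_pow_left₀ (abs_nonneg _) ((abs_add_le _ _).trans (by linarith)) 2
  have hρ2 : (ε * ρ) ^ 2 ≤ (ε * D2) ^ 2 := by
    rw [← sq_abs (ε * ρ), abs_mul, abs_of_pos hε]
    exact pow_le_pow_left₀ (by positivity) (by gcongr) 2
  have hr' : |(L - j) * r| ≤ L * D1 := by
    rw [abs_mul, abs_of_nonneg (by linarith : (0 : ℝ) ≤ L - j)]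
    exact mul_le_mul (by linarith) hr (abs_nonneg _) (by linarith)
  have hr1 := abs_le.1 hr'
  have hρ1 := abs_le.1 hρ
  -- The threshold on `|c|` makes `L |c|` exceed the errors `L D1 + D2` by at least `1`, so the
  -- linear coefficient has the sign of `c` and absolute value at least `1`.
  have hlin : (a + ε * s.2 i) * (L * c + (L - j) * r + ρ) ≤
      SignType.sign c * (a + ε * s.2 i) := by
    rcases lt_or_ge 0 c with hcpos | hcneg
    · rw [abs_of_pos hcpos] at hfar
      rw [sign_pos hcpos] at ha ⊢
      simp only [SignType.coe_one] at ha ⊢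
      have hLc := mul_le_mul_of_nonneg_left hfar.le (by linarith : (0 : ℝ) ≤ L)
      have hLD := le_mul_of_one_le_left hD20 hL1
      have h1 : 1 ≤ L * c + (L - j) * r + ρ := by linarith
      have h2 := mul_le_mul_of_nonpos_left h1 (by linarith : a + ε * s.2 i ≤ 0)
      linarith
    · have hcneg' : c < 0 := by
        rcases hcneg.lt_or_eq with h | h
        · exact h
        · rw [h, abs_zero] at hfar; linarith
      rw [abs_of_neg hcneg'] at hfar
      rw [sign_neg hcneg'] at ha ⊢
      simp only [SignType.coe_neg_one] at ha ⊢
      have hLc := mul_le_mul_of_nonneg_left hfar.le (by linarith : (0 : ℝ) ≤ L)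
      have hLD := le_mul_of_one_le_left hD20 hL1
      have h1 : L * c + (L - j) * r + ρ ≤ -1 := by linarith
      have h2 := mul_le_mul_of_nonneg_left h1 (by linarith : 0 ≤ a + ε * s.2 i)
      linarith
  linarith [sq_nonneg c]

/-- Lower bound for the energy gained along a line, when the pivot is early. -/
theorem exists_le_energy_gain {n : ℕ} {G : (Fin n → ℝ) → Fin n → ℝ} {M ε : ℝ} (hε : 0 < ε)
    (hM0 : 0 ≤ M) (hGM : ∀ x i, |G x i| ≤ M) {L j : ℕ} (hL : 1 ≤ L) (hj : j ≤ L) (i : Fin n)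
    (s : Phase n) (hLj : 2 * j < L) :
    ∃ P : ℝ, 0 ≤ P ∧ ∀ a, 0 ≤ a + ε * s.2 i →
      (a + ε * s.2 i) ^ 2 / 2 ≤
        energy ((leap G ε)^[L] (pivot ε j i s a)) - energy (pivot ε j i s a) +
          (a + ε * s.2 i) * P + P := by
  obtain ⟨B, hB⟩ := exists_bound_energy_rest hε hGM L j i s
  have hB0 : 0 ≤ B := (abs_nonneg _).trans (hB 0)
  have hL1 : (1 : ℝ) ≤ L := by exact_mod_cast hL
  have hj1 : (j : ℝ) ≤ L := by exact_mod_cast hj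
  have hj0 : (0 : ℝ) ≤ j := Nat.cast_nonneg j
  have hD10 : 0 ≤ L * (L + 1) * (ε * ε * M) := by positivity
  have hD20 : 0 ≤ L * M := by positivity
  have hcoord := exists_energy_coord hε hGM L j i s
  generalize hcdef : s.1 i + j * ε * s.2 i = c at *
  generalize hD1 : L * (L + 1) * (ε * ε * M) = D1 at *
  generalize hD2 : L * M = D2 at *
  refine ⟨L * |c| + L * D1 + D2 + c ^ 2 / 2 + B, by positivity, fun a ha => ?_⟩
  obtain ⟨r, ρ, hr, hρ, e⟩ := hcoord a
  have hBa := hB a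
  rw [e] at hBa
  have hBa' := (abs_le.1 hBa).1
  -- `2j < L` holds between integers, so the coefficient `L (L - 2j)` is at least `1`.
  have hquad : (a + ε * s.2 i) ^ 2 / 2 ≤ L * (L - 2 * j) * (a + ε * s.2 i) ^ 2 / 2 := by
    have h1 : (1 : ℝ) ≤ L - 2 * j := by
      have : 2 * j + 1 ≤ L := hLj
      have : (2 * j + 1 : ℝ) ≤ L := by exact_mod_cast this
      linarith
    have h2 : (1 : ℝ) ≤ L * (L - 2 * j) := one_le_mul_of_one_le_of_one_le hL1 h1
    nlinarith [sq_nonneg (a + ε * s.2 i)]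
  have hr' : |(L - j) * r| ≤ L * D1 := by
    rw [abs_mul, abs_of_nonneg (by linarith : (0 : ℝ) ≤ L - j)]
    exact mul_le_mul (by linarith) hr (abs_nonneg _) (by linarith)
  have hr1 := abs_le.1 hr'
  have hρ1 := abs_le.1 hρ
  have hc1 : -(L * |c|) ≤ L * c := by nlinarith [neg_abs_le c]
  have hlin : -((a + ε * s.2 i) * (L * |c| + L * D1 + D2)) ≤
      (a + ε * s.2 i) * (L * c + (L - j) * r + ρ) := by
    rw [← mul_neg]
    exact mul_le_mul_of_nonneg_left (by linarith) ha
  have hx : 0 ≤ (a + ε * s.2 i) * (c ^ 2 / 2 + B) := by positivity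
  have hy : 0 ≤ L * |c| + L * D1 + D2 := by positivity
  linarith [sq_nonneg (c + r), sq_nonneg (ε * ρ)]

/-- The energy cannot be conserved along almost all of a line of states. -/
theorem not_ae_conserved_on_pivot {w : Trace → ℝ} {A : Set Trace} {c₀ : ℝ} (h0 : ∀ t, 0 ≤ w t)
    (ht : TreeRepresentable w) (hc₀ : 0 < c₀) (hc : ∀ t, 0 < w t → c₀ ≤ w t) {M : ℝ} (hM0 : 0 ≤ M)
    {n : ℕ} (hM : ∀ q ∈ regularPoints w A n, ∀ i, |gradU w n q i| ≤ M) {K : NNReal}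
    (hK : LipschitzOnWith K (gradU w n) (regularPoints w A n)) {ε : ℝ} (hε : 0 < ε) {L j : ℕ}
    (hL : 1 ≤ L) (hj : j ≤ L) (i : Fin n) (s : Phase n) {τ : ℝ} (hτ : 0 < τ)
    (hfar : L ≤ 2 * j →
      L * (L + 1) * (ε * ε * M) + L * M + 1 < |s.1 i + j * ε * s.2 i|)
    (hae : ∀ᵐ a : ℝ, (∀ l ≤ L, ((leapfrog w ε n)^[l] (pivot ε j i s a)).1 ∈ regularPoints w A n) ∧
      trunc w n (integrator w ε L n (pivot ε j i s a)).1 *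
        normalDensity (integrator w ε L n (pivot ε j i s a)) =
          τ * normalDensity (pivot ε j i s a)) : False := by
  obtain ⟨G, hG, hGM, hGS⟩ := exists_bounded_lipschitz_extension hM0 hK hM
  set gain : ℝ → ℝ := fun a =>
    energy ((leap G ε)^[L] (pivot ε j i s a)) - energy (pivot ε j i s a) with hgain
  set S : Set ℝ := {a | (leap G ε)^[L] (pivot ε j i s a) = (leapfrog w ε n)^[L] (pivot ε j i s a) ∧
    ((leap G ε)^[L] (pivot ε j i s a)).1 ∈ regularPoints w A n ∧
    trunc w n ((leap G ε)^[L] (pivot ε j i s a)).1 = τ * Real.exp (gain a)} with hSdef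
  -- Conservation is rewritten for the flow of `G`, whose energy gain is continuous in `a` although
  -- `w` need not be.
  have hS : ∀ᵐ a, a ∈ S := by
    filter_upwards [hae] with a ha
    obtain ⟨ha1, ha2⟩ := ha
    have e := leap_iterate_congr (g' := G) hGS ha1 L le_rfl
    refine ⟨e, e ▸ ha1 L le_rfl, ?_⟩
    rw [integrator_eq, normalDensity_eq, normalDensity_eq, energy_flip, leapfrog_eq, ← e] at ha2
    have hp : 0 < (Real.sqrt (2 * Real.pi))⁻¹ ^ n * (Real.sqrt (2 * Real.pi))⁻¹ ^ n := by positivity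
    set Z := (Real.sqrt (2 * Real.pi))⁻¹ ^ n * (Real.sqrt (2 * Real.pi))⁻¹ ^ n
    have h3 : trunc w n ((leap G ε)^[L] (pivot ε j i s a)).1 *
        Real.exp (-energy ((leap G ε)^[L] (pivot ε j i s a))) =
        τ * Real.exp (-energy (pivot ε j i s a)) := by
      refine mul_left_cancel₀ hp.ne' ?_
      rw [mul_left_comm, mul_left_comm Z τ]
      exact ha2
    rw [hgain]
    simp only
    rw [sub_eq_add_neg, Real.exp_add, mul_left_comm, ← h3, Real.exp_neg]
    field_simp
  set c := s.1 i + j * ε * s.2 i with hcdef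
  set D1 := L * (L + 1) * (ε * ε * M) with hD1
  set D2 := L * M with hD2
  have hD10 : 0 ≤ D1 := by positivity
  have hD20 : 0 ≤ D2 := by positivity
  have hL1 : (1 : ℝ) ≤ L := by exact_mod_cast hL
  have hj1 : (j : ℝ) ≤ L := by exact_mod_cast hj
  have hj0 : (0 : ℝ) ≤ j := Nat.cast_nonneg j
  rcases le_or_gt L (2 * j) with hLj | hLj
  -- Late pivot: (C2) bounds the gain from below on `S`, which is dense, yet the gain tends to `-∞`
  -- when `a` moves against the sign of `c`.
  · have hLj' : (L : ℝ) ≤ 2 * j := by exact_mod_cast hLj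
    have hfar' := hfar hLj
    obtain ⟨P, hP⟩ := exists_energy_gain_le hε hM0 hGM hL hj i s hLj hfar'
    rw [← hcdef] at hP
    have hlow : ∀ a ∈ S, Real.log (c₀ / τ) ≤ gain a := by
      rintro a ⟨-, h1, h2⟩
      have := le_trunc h0 ht hc h1.2.1
      rw [h2] at this
      rw [Real.log_le_iff_le_exp (by positivity), div_le_iff₀ hτ]
      linarith
    have hdense := Measure.dense_of_ae hS
    have hcne : c ≠ 0 := by
      intro h
      rw [h, abs_zero] at hfar'
      linarith
    rcases lt_or_gt_of_ne hcne with hcneg | hcpos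
    · rw [sign_neg hcneg] at hP
      simp only [SignType.coe_neg_one] at hP
      obtain ⟨a, haS, ha⟩ := hdense.exists_gt (max 0 (P - Real.log (c₀ / τ)) - ε * s.2 i)
      have h1 := hP a (by linarith [le_max_left 0 (P - Real.log (c₀ / τ))])
      have h2 := hlow a haS
      linarith [le_max_right 0 (P - Real.log (c₀ / τ))]
    · rw [sign_pos hcpos] at hP
      simp only [SignType.coe_one] at hP
      obtain ⟨a, haS, ha⟩ := hdense.exists_lt (-max 0 (P - Real.log (c₀ / τ)) - ε * s.2 i)
      have h1 := hP a (by linarith [le_max_left 0 (P - Real.log (c₀ / τ))])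
      have h2 := hlow a haS
      linarith [le_max_right 0 (P - Real.log (c₀ / τ))]
  · obtain ⟨K1, hK1⟩ := exists_lipschitzWith_leap hG ε L
    obtain ⟨K2, hK2⟩ := exists_lipschitzWith_pivot ε j i s
    have hLip : LipschitzWith (K1 * K2) fun a => ((leap G ε)^[L] (pivot ε j i s a)).1 := by
      have := LipschitzWith.prod_fst.comp (hK1.comp hK2)
      rwa [one_mul] at this
    have hloc : LocallyLipschitz gain :=
      locallyLipschitz_energy_sub (f := (leap G ε)^[L] ∘ pivot ε j i s)
        (hK1.comp hK2).locallyLipschitz hK2.locallyLipschitz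
    -- `n M` bounds the derivative of `log w_{≤n}` for the sup norm, `1` absorbs the remainder of
    -- the linear approximation, and `K1 * K2` is the Lipschitz constant of the end point in `a`.
    set C : ℝ := (n * M + 1) * (K1 * K2 : NNReal) with hC
    have hC0 : 0 ≤ C := by positivity
    have hslope := abs_sub_le_of_ae_slope hloc hC0 hS (by
      rintro a ⟨-, ha1, ha2⟩
      have hev := hLip.continuous.continuousAt.eventually
        (eventually_abs_log_trunc_sub_le ha1.2.2 ha1.2.1 (hM _ ha1))
      filter_upwards [hev] with b hb hbS
      obtain ⟨-, hb1, hb2⟩ := hbS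
      rw [ha2, hb2, Real.log_mul hτ.ne' (Real.exp_ne_zero _), Real.log_mul hτ.ne'
        (Real.exp_ne_zero _), Real.log_exp, Real.log_exp, add_sub_add_left_eq_sub] at hb
      refine hb.trans ?_
      rw [hC, mul_assoc]
      gcongr
      rw [← dist_eq_norm, ← Real.dist_eq]
      exact hLip.dist_le_mul b a)
    obtain ⟨P, hP0, hP⟩ := exists_le_energy_gain hε hM0 hGM hL hj i s hLj
    set e := ε * s.2 i
    -- Chosen so that `b² / 2 > b (P + C) + (P + |gain 0| + C |e|)`, against the combined quadratic
    -- lower and linear upper bounds.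
    set b := 2 * (P + C + (P + |gain 0| + C * |e|) + 1) with hb
    have hb1 : 1 ≤ b := by
      have : 0 ≤ C * |e| := by positivity
      linarith [abs_nonneg (gain 0)]
    have h1 := hP (b - e) (by linarith)
    have h2 := hslope 0 (b - e)
    rw [sub_zero] at h2
    have h3 : |b - e| ≤ b + |e| := by
      have := abs_sub b e
      rwa [abs_of_pos (by linarith : 0 < b)] at this
    have h4 : C * |b - e| ≤ C * (b + |e|) := mul_le_mul_of_nonneg_left h3 hC0
    have h5 := (abs_le.1 h2).2
    have h6 := le_abs_self (gain 0)
    rw [sub_add_cancel] at h1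
    have h7 : 0 ≤ C * |e| := by positivity
    nlinarith [abs_nonneg (gain 0)]

/-! ### Normal distributions in different dimensions -/

instance (n : ℕ) : IsProbabilityMeasure (stdNormal n) := by
  unfold stdNormal; infer_instance

theorem stdNormal_absolutelyContinuous (n : ℕ) :
    stdNormal n ≪ volume ∧ volume ≪ stdNormal n := by
  induction n with
  | zero =>
    have : stdNormal 0 = volume := by
      rw [stdNormal, volume_pi]
      congr 1
      funext i
      exact i.elim0
    rw [this]
    exact ⟨Measure.AbsolutelyContinuous.rfl, Measure.AbsolutelyContinuous.rfl⟩
  | succ n ih =>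
    have h1 := measurePreserving_piFinSuccAbove (fun _ : Fin (n + 1) => gaussianReal 0 1) 0
    have h2 := measurePreserving_piFinSuccAbove (fun _ : Fin (n + 1) => (volume : Measure ℝ)) 0
    have e1 : stdNormal (n + 1) = ((gaussianReal 0 1).prod (stdNormal n)).map
        (MeasurableEquiv.piFinSuccAbove (fun _ => ℝ) 0).symm :=
      (h1.symm _).map_eq.symm
    have e2 : (volume : Measure (Fin (n + 1) → ℝ)) = ((volume : Measure ℝ).prod
        (volume : Measure (Fin n → ℝ))).map
        (MeasurableEquiv.piFinSuccAbove (fun _ => ℝ) 0).symm :=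
      (h2.symm _).map_eq.symm
    have hv : (1 : NNReal) ≠ 0 := one_ne_zero
    rw [e1, e2]
    exact ⟨((gaussianReal_absolutelyContinuous 0 hv).prod ih.1).map (MeasurableEquiv.measurable _),
      ((gaussianReal_absolutelyContinuous' 0 hv).prod ih.2).map (MeasurableEquiv.measurable _)⟩

/-- The standard normal distribution on the sequence space. -/
abbrev seqNormal : Measure (ℕ → ℝ) := Measure.infinitePi fun _ => gaussianReal 0 1

theorem measurePreserving_initial (n : ℕ) :
    MeasurePreserving (fun (x : ℕ → ℝ) (i : Fin n) => x i) seqNormal (stdNormal n) := by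
  refine ⟨by fun_prop, (Measure.pi_eq fun s hs => ?_).symm⟩
  rw [Measure.map_apply (by fun_prop) (MeasurableSet.univ_pi hs)]
  have e : (fun (x : ℕ → ℝ) (i : Fin n) => x i) ⁻¹' Set.univ.pi s =
      Set.pi (Finset.range n : Set ℕ) (fun k => if h : k < n then s ⟨k, h⟩ else Set.univ) := by
    ext x
    simp only [Set.mem_preimage, Set.mem_pi, Set.mem_univ, true_imp_iff, Finset.coe_range,
      Set.mem_Iio]
    constructor
    · intro h k hk
      simpa [hk] using h ⟨k, hk⟩
    · intro h i
      simpa using h i i.isLt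
  rw [e, Measure.infinitePi_pi, ← Fin.prod_univ_eq_prod_range
    (fun k => gaussianReal 0 1 (if h : k < n then s ⟨k, h⟩ else Set.univ)) n]
  · simp
  · intro k hk
    rw [Finset.mem_range] at hk
    simpa [hk] using hs ⟨k, hk⟩

theorem measurePreserving_pre {n k : ℕ} (h : k ≤ n) :
    MeasurePreserving (fun q : Fin n → ℝ => pre q h) (stdNormal n) (stdNormal k) := by
  refine ⟨measurable_pre h, ?_⟩
  rw [← (measurePreserving_initial n).map_eq, Measure.map_map (measurable_pre h) (by fun_prop),
    ← (measurePreserving_initial k).map_eq]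
  rfl

theorem measurable_append (n m : ℕ) :
    Measurable fun z : (Fin n → ℝ) × (Fin m → ℝ) => (Fin.append z.1 z.2 : Fin (n + m) → ℝ) := by
  rw [measurable_pi_iff]
  intro i
  refine Fin.addCases (fun i => ?_) (fun i => ?_) i
  · simp only [Fin.append_left]; fun_prop
  · simp only [Fin.append_right]; fun_prop

theorem measurePreserving_append (n m : ℕ) :
    MeasurePreserving (fun z : (Fin n → ℝ) × (Fin m → ℝ) => (Fin.append z.1 z.2 : Fin (n + m) → ℝ))
      ((stdNormal n).prod (stdNormal m)) (stdNormal (n + m)) := by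
  refine ⟨measurable_append n m, (Measure.pi_eq fun s hs => ?_).symm⟩
  rw [Measure.map_apply (measurable_append n m) (MeasurableSet.univ_pi hs)]
  have e : (fun z : (Fin n → ℝ) × (Fin m → ℝ) => (Fin.append z.1 z.2 : Fin (n + m) → ℝ)) ⁻¹'
      Set.univ.pi s = (Set.univ.pi fun i => s (Fin.castAdd m i)) ×ˢ
        (Set.univ.pi fun i => s (Fin.natAdd n i)) := by
    ext z
    simp only [Set.mem_preimage, Set.mem_pi, Set.mem_univ, true_imp_iff, Set.mem_prod]
    constructor
    · intro h
      exact ⟨fun i => by simpa using h (Fin.castAdd m i), fun i => by simpa using h (Fin.natAdd n i)⟩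
    · rintro ⟨h1, h2⟩ i
      refine Fin.addCases (fun i => ?_) (fun i => ?_) i
      · simpa using h1 i
      · simpa using h2 i
  rw [e, Measure.prod_prod, stdNormal, stdNormal, Measure.pi_pi, Measure.pi_pi, Fin.prod_univ_add]

theorem pre_append {n m : ℕ} (q : Fin n → ℝ) (x : Fin m → ℝ) (h : n ≤ n + m) :
    pre (Fin.append q x) h = q := by
  funext i
  exact Fin.append_left q x i

/-- The standard normal distribution on the phase space. -/
abbrev phaseNormal (n : ℕ) : Measure (Phase n) := (stdNormal n).prod (stdNormal n)

theorem measurable_preS {n k : ℕ} (h : k ≤ n) : Measurable fun s : Phase n => preS s h :=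
  ((measurable_pre h).comp measurable_fst).prodMk ((measurable_pre h).comp measurable_snd)

theorem measurePreserving_preS {n k : ℕ} (h : k ≤ n) :
    MeasurePreserving (fun s : Phase n => preS s h) (phaseNormal n) (phaseNormal k) :=
  (measurePreserving_pre h).prod (measurePreserving_pre h)

/-- A pair of independent infinite sequences of independent standard normals. -/
abbrev pathNormal : Measure ((ℕ → ℝ) × (ℕ → ℝ)) := seqNormal.prod seqNormal

/-- The state of dimension `n` given by the initial segments of two sequences. -/
def initialState (n : ℕ) (x : (ℕ → ℝ) × (ℕ → ℝ)) : Phase n := (fun i => x.1 i, fun i => x.2 i)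

theorem measurable_initialState (n : ℕ) : Measurable (initialState n) := by
  unfold initialState; fun_prop

theorem measurePreserving_initialState (n : ℕ) :
    MeasurePreserving (initialState n) pathNormal (phaseNormal n) :=
  (measurePreserving_initial n).prod (measurePreserving_initial n)

theorem isAddRightInvariant_volume_phase (n : ℕ) :
    (volume : Measure (Phase n)).IsAddRightInvariant := by
  rw [Measure.volume_eq_prod]
  infer_instance

/-- Leapfrog steps and translations preserve Lebesgue measure rather than the normal distribution,
but the two have the same null sets. -/
theorem quasiMeasurePreserving_phaseNormal {n : ℕ} {f : Phase n → Phase n}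
    (hf : MeasurePreserving f volume volume) :
    Measure.QuasiMeasurePreserving f (phaseNormal n) (phaseNormal n) := by
  obtain ⟨h1, h2⟩ := stdNormal_absolutelyContinuous n
  exact (hf.quasiMeasurePreserving.mono_left (h1.prod h1)).mono_right (h2.prod h2)

theorem ae_phaseNormal_iff {n : ℕ} {p : Phase n → Prop} :
    (∀ᵐ s ∂phaseNormal n, p s) ↔ ∀ᵐ s : Phase n, p s := by
  obtain ⟨h1, h2⟩ := stdNormal_absolutelyContinuous n
  exact ⟨fun h => (h2.prod h2).ae_le h, fun h => (h1.prod h1).ae_le h⟩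

/-- Kicks and drifts are shears, translating one variable by a function of the other. Measurability
of `g` suffices; the drift becomes a shear in the second variable after a swap. -/
theorem measurePreserving_leap {n : ℕ} {g : (Fin n → ℝ) → Fin n → ℝ} (hg : Measurable g) (ε : ℝ) :
    MeasurePreserving (leap g ε) (volume : Measure (Phase n)) volume := by
  have hK : MeasurePreserving (fun s : Phase n => (s.1, s.2 - (ε / 2) • g s.1)) volume volume := by
    refine (MeasurePreserving.id volume).skew_product (g := fun q p => p - (ε / 2) • g q)
      (by fun_prop) (Filter.Eventually.of_forall fun q => ?_)
    exact (measurePreserving_sub_right volume ((ε / 2) • g q)).map_eq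
  have hD : MeasurePreserving (fun s : Phase n => (s.1 + ε • s.2, s.2)) volume volume := by
    have h1 : MeasurePreserving (fun s : Phase n => (s.1, s.2 + ε • s.1)) volume volume := by
      refine (MeasurePreserving.id volume).skew_product (g := fun q p => p + ε • q)
        (by fun_prop) (Filter.Eventually.of_forall fun q => ?_)
      exact (measurePreserving_add_right volume (ε • q)).map_eq
    have hs : MeasurePreserving (Prod.swap : Phase n → Phase n) volume volume :=
      Measure.measurePreserving_swap
    exact hs.comp (h1.comp hs)
  exact hK.comp (hD.comp hK)

theorem measurePreserving_flip {n : ℕ} :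
    MeasurePreserving (flip : Phase n → Phase n) volume volume :=
  (MeasurePreserving.id volume).prod (Measure.measurePreserving_neg volume)

theorem measurable_leapfrog {w : Trace → ℝ} (hw : Measurable w) (ε : ℝ) (n : ℕ) :
    Measurable (leapfrog w ε n) :=
  (measurePreserving_leap (measurable_gradU hw n) ε).measurable

theorem quasiMeasurePreserving_iterate {w : Trace → ℝ} (hw : Measurable w) (ε : ℝ) (n l : ℕ) :
    Measure.QuasiMeasurePreserving ((leapfrog w ε n)^[l]) (phaseNormal n) (phaseNormal n) :=
  quasiMeasurePreserving_phaseNormal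
    ((measurePreserving_leap (measurable_gradU hw n) ε).iterate l)

theorem quasiMeasurePreserving_integrator {w : Trace → ℝ} (hw : Measurable w) (ε : ℝ) (L n : ℕ) :
    Measure.QuasiMeasurePreserving (integrator w ε L n) (phaseNormal n) (phaseNormal n) :=
  quasiMeasurePreserving_phaseNormal
    (measurePreserving_flip.comp ((measurePreserving_leap (measurable_gradU hw n) ε).iterate L))

/-! ### Almost all states are good -/

theorem ae_mem_goodPoints {A : Set Trace} (hA : traceMeasure Aᶜ = 0) (n : ℕ) :
    ∀ᵐ q ∂stdNormal n, q ∈ goodPoints A n := by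
  have h1 : ∀ k, ∀ᵐ q ∂stdNormal k, (⟨k, q⟩ : Trace) ∈ A := by
    intro k
    rw [traceMeasure, Measure.sum_apply_eq_zero] at hA
    exact ae_of_ae_map (measurable_sigmaMk k).aemeasurable (hA k)
  have h2 : ∀ k : ℕ, ∀ᵐ q ∂stdNormal n, ∀ hk : k ≤ n, (⟨k, pre q hk⟩ : Trace) ∈ A := by
    intro k
    by_cases hk : k ≤ n
    · filter_upwards [(measurePreserving_pre hk).quasiMeasurePreserving.ae (h1 k)] with q hq _
      exact hq
    · exact Filter.Eventually.of_forall fun q hk' => absurd hk' hk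
  filter_upwards [ae_all_iff.2 h2] with q hq k hk
  exact hq k hk

theorem ae_mem_goodStates {w : Trace → ℝ} (hw : Measurable w) {A : Set Trace}
    (hA : traceMeasure Aᶜ = 0) (ε : ℝ) (L n : ℕ) :
    ∀ᵐ s ∂phaseNormal n, s ∈ goodStates w A ε L n := by
  have h : ∀ l : ℕ, ∀ᵐ s ∂phaseNormal n, ((leapfrog w ε n)^[l] s).1 ∈ goodPoints A n := fun l =>
    ((Measure.quasiMeasurePreserving_fst (μ := stdNormal n) (ν := stdNormal n)).comp
      (quasiMeasurePreserving_iterate hw ε n l)).ae (ae_mem_goodPoints hA n)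
  filter_upwards [ae_all_iff.2 h] with s hs l _
  exact hs l

theorem quasiMeasurePreserving_add {n : ℕ} (v : Phase n) :
    Measure.QuasiMeasurePreserving (fun s => s + v) (phaseNormal n) (phaseNormal n) := by
  have hinv := isAddRightInvariant_volume_phase n
  exact quasiMeasurePreserving_phaseNormal (measurePreserving_add_right volume v)

/-- Along almost every line, almost all states have a property that holds almost everywhere. -/
theorem ae_ae_pivot {n : ℕ} {p : Phase n → Prop} (hp : ∀ᵐ s ∂phaseNormal n, p s) (ε : ℝ) (j : ℕ)
    (i : Fin n) : ∀ᵐ s ∂phaseNormal n, ∀ᵐ a : ℝ, p (pivot ε j i s a) := by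
  rw [ae_phaseNormal_iff] at hp ⊢
  set v : Phase n := (Pi.single i (-(j : ℝ)), Pi.single i ε⁻¹) with hv
  have hinv := isAddRightInvariant_volume_phase n
  -- For each fixed `a` the map is a translation, so the exceptional set has a null preimage in the
  -- product, and Fubini applies.
  have h : Measure.QuasiMeasurePreserving (fun z : Phase n × ℝ => pivot ε j i z.1 z.2)
      ((volume : Measure (Phase n)).prod (volume : Measure ℝ)) volume := by
    have h1 : MeasurePreserving (fun z : ℝ × Phase n => (z.1, z.2 + z.1 • v))
        ((volume : Measure ℝ).prod (volume : Measure (Phase n)))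
        ((volume : Measure ℝ).prod (volume : Measure (Phase n))) :=
      (MeasurePreserving.id volume).skew_product (g := fun a s => s + a • v)
        (by fun_prop) (Filter.Eventually.of_forall fun a =>
          (measurePreserving_add_right (volume : Measure (Phase n)) (a • v)).map_eq)
    have h2 := (Measure.quasiMeasurePreserving_snd (μ := (volume : Measure ℝ))
      (ν := (volume : Measure (Phase n)))).comp
      (h1.comp Measure.measurePreserving_swap).quasiMeasurePreserving
    have e : (fun z : Phase n × ℝ => pivot ε j i z.1 z.2) =
        Prod.snd ∘ (fun z : ℝ × Phase n => (z.1, z.2 + z.1 • v)) ∘ Prod.swap :=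
      funext fun z => pivot_eq_add_smul ε j i z.1 z.2
    rw [e]
    exact h2
  exact Measure.ae_ae_of_ae_prod (h.ae hp)

/-! ### Measurability of the algorithm -/

theorem supported_eq {w : Trace → ℝ} (ht : TreeRepresentable w) {n k : ℕ} (s : Phase n)
    (hk : k ≤ n) (h : 0 < w ⟨k, pre s.1 hk⟩) : supported w ⟨n, s⟩ = ⟨k, pre s.1 hk⟩ := by
  classical
  have hex : ∃ k, ∃ hk : k ≤ n, 0 < w ⟨k, pre s.1 hk⟩ := ⟨k, hk, h⟩
  have aux : ∀ m (hm : m = k) (h' : m ≤ n), (⟨m, pre s.1 h'⟩ : Trace) = ⟨k, pre s.1 hk⟩ := by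
    rintro m rfl h'; rfl
  unfold supported
  rw [dif_pos hex]
  obtain ⟨h1, h2⟩ := Nat.find_spec hex
  exact aux _ (ht.eq_of_pos h1 hk h2 h) _

theorem exists_supported_eq {w : Trace → ℝ} (h0 : ∀ t, 0 ≤ w t) (ht : TreeRepresentable w) {n : ℕ}
    {s : Phase n} (h : 0 < trunc w n s.1) :
    ∃ k, ∃ hk : k ≤ n, 0 < w ⟨k, pre s.1 hk⟩ ∧ supported w ⟨n, s⟩ = ⟨k, pre s.1 hk⟩ := by
  obtain ⟨k, hk, hw⟩ := (trunc_pos_iff h0).1 h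
  exact ⟨k, hk, hw, supported_eq ht s hk hw⟩

theorem trunc_pos_of_mem_valid {w : Trace → ℝ} {ε : ℝ} {L n : ℕ} {s : Phase n}
    (h : (⟨n, s⟩ : State) ∈ Valid w ε L) : 0 < trunc w n s.1 := h.1 0 (Nat.zero_le _)

theorem measurableSet_staysInDomain {w : Trace → ℝ} (hw : Measurable w) (ε : ℝ) (L n : ℕ) :
    MeasurableSet {s : Phase n | StaysInDomain w ε L n s} := by
  have : {s : Phase n | StaysInDomain w ε L n s} =
      ⋂ j, ⋂ _ : j ≤ L, {s | 0 < trunc w n ((leapfrog w ε n)^[j] s).1} := by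
    ext s; simp [StaysInDomain]
  rw [this]
  refine MeasurableSet.iInter fun j => MeasurableSet.iInter fun _ => ?_
  exact measurableSet_lt measurable_const ((measurable_trunc hw n).comp
    (measurable_fst.comp ((measurable_leapfrog hw ε n).iterate j)))

theorem measurableSet_valid {w : Trace → ℝ} (hw : Measurable w) (ε : ℝ) (L : ℕ) :
    MeasurableSet (Valid w ε L) := by
  refine measurableSet_sigma fun n => ?_
  have : Sigma.mk n ⁻¹' Valid w ε L = {s : Phase n | StaysInDomain w ε L n s} ∩
      ⋂ k, ⋂ hk : k < n, ((fun s : Phase n => preS s hk.le) ⁻¹'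
        {s : Phase k | StaysInDomain w ε L k s})ᶜ := by
    ext s; simp [Valid, preS]
  rw [this]
  refine (measurableSet_staysInDomain hw ε L n).inter
    (MeasurableSet.iInter fun k => MeasurableSet.iInter fun hk => ?_)
  exact (measurable_preS hk.le (measurableSet_staysInDomain hw ε L k)).compl

theorem measurableSet_supported_inter_valid {w : Trace → ℝ} (h0 : ∀ t, 0 ≤ w t)
    (ht : TreeRepresentable w) (hw : Measurable w) (ε : ℝ) (L : ℕ) {B : Set Trace}
    (hB : MeasurableSet B) : MeasurableSet (supported w ⁻¹' B ∩ Valid w ε L) := by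
  refine measurableSet_sigma fun n => ?_
  have : Sigma.mk n ⁻¹' (supported w ⁻¹' B ∩ Valid w ε L) = Sigma.mk n ⁻¹' Valid w ε L ∩
      ⋃ k, ⋃ hk : k ≤ n, (fun s : Phase n => (⟨k, pre s.1 hk⟩ : Trace)) ⁻¹' ({t | 0 < w t} ∩ B) := by
    ext s
    simp only [Set.mem_preimage, Set.mem_inter_iff, Set.mem_iUnion, Set.mem_ofPred_eq]
    constructor
    · rintro ⟨h1, h2⟩
      obtain ⟨k, hk, hw, he⟩ := exists_supported_eq h0 ht (trunc_pos_of_mem_valid h2)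
      exact ⟨h2, k, hk, hw, he ▸ h1⟩
    · rintro ⟨h1, k, hk, hw, h2⟩
      exact ⟨(supported_eq ht s hk hw).symm ▸ h2, h1⟩
  rw [this]
  refine (measurable_sigmaMk (β := Phase) n (measurableSet_valid hw ε L)).inter
    (MeasurableSet.iUnion fun k => MeasurableSet.iUnion fun hk => ?_)
  exact ((measurable_sigmaMk (β := fun n => Fin n → ℝ) k).comp
    ((measurable_pre hk).comp measurable_fst))
    ((measurableSet_lt measurable_const hw).inter hB)

theorem measurable_integrator {w : Trace → ℝ} (hw : Measurable w) (ε : ℝ) (L n : ℕ) :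
    Measurable (integrator w ε L n) :=
  (quasiMeasurePreserving_integrator hw ε L n).measurable

theorem measurable_normalDensity (n : ℕ) : Measurable (normalDensity : Phase n → ℝ) := by
  have : (normalDensity : Phase n → ℝ) = _ := funext fun s => normalDensity_eq s
  rw [this]
  exact measurable_const.mul (Real.measurable_exp.comp contDiff_energy.continuous.measurable.neg)

theorem measurable_accept {w : Trace → ℝ} (hw : Measurable w) (ε : ℝ) (L n : ℕ) :
    Measurable fun s : Phase n => accept w ε L ⟨n, s⟩ := by
  have h1 := measurable_integrator hw ε L n
  refine measurable_const.min (Measurable.div ?_ ?_)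
  · exact ((measurable_trunc hw n).comp (measurable_fst.comp h1)).mul
      ((measurable_normalDensity n).comp h1)
  · exact ((measurable_trunc hw n).comp measurable_fst).mul (measurable_normalDensity n)

theorem accept_le_one (w : Trace → ℝ) (ε : ℝ) (L : ℕ) (s : State) : accept w ε L s ≤ 1 :=
  min_le_left _ _

theorem accept_nonneg {w : Trace → ℝ} (h0 : ∀ t, 0 ≤ w t) (ε : ℝ) (L : ℕ) (s : State) :
    0 ≤ accept w ε L s := by
  have h : ∀ (n : ℕ) (s : Phase n), 0 ≤ trunc w n s.1 * normalDensity s := fun n s =>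
    mul_nonneg (Finset.sum_nonneg fun k _ => h0 _) (normalDensity_pos s).le
  exact le_min zero_le_one (div_nonneg (h _ _) (h _ _))

theorem integrateAccept_apply (w : Trace → ℝ) (ε : ℝ) (L : ℕ) (s : State) {X : Set State}
    (hX : MeasurableSet X) : integrateAccept w ε L s X =
      ENNReal.ofReal (accept w ε L s) * X.indicator 1 ⟨s.1, integrator w ε L s.1 s.2⟩ +
      ENNReal.ofReal (1 - accept w ε L s) * X.indicator 1 s := by
  simp [integrateAccept, Measure.dirac_apply' _ hX]

theorem integrateAccept_le_one {w : Trace → ℝ} (h0 : ∀ t, 0 ≤ w t) (ε : ℝ) (L : ℕ) (s : State)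
    {X : Set State} (hX : MeasurableSet X) : integrateAccept w ε L s X ≤ 1 := by
  have hi : ∀ t, X.indicator (1 : State → ENNReal) t ≤ 1 := fun t =>
    Set.indicator_le_self' (fun _ _ => zero_le) t
  rw [integrateAccept_apply w ε L s hX]
  calc _ ≤ ENNReal.ofReal (accept w ε L s) * 1 + ENNReal.ofReal (1 - accept w ε L s) * 1 := by
        gcongr <;> exact hi _
    _ = 1 := by
        rw [mul_one, mul_one, ← ENNReal.ofReal_add (accept_nonneg h0 ε L s)
          (sub_nonneg.2 (accept_le_one w ε L s))]
        simp

theorem measurable_integrateAccept {w : Trace → ℝ} (hw : Measurable w) (ε : ℝ) (L : ℕ)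
    {X : Set State} (hX : MeasurableSet X) (n : ℕ) :
    Measurable fun s : Phase n => integrateAccept w ε L ⟨n, s⟩ X := by
  simp_rw [integrateAccept_apply w ε L _ hX]
  have hi : Measurable (X.indicator (1 : State → ENNReal)) := measurable_one.indicator hX
  have hm := measurable_sigmaMk (β := Phase) n
  have ha := measurable_accept hw ε L n
  refine (Measurable.mul ha.ennreal_ofReal ?_).add (Measurable.mul ?_ (hi.comp hm))
  · exact hi.comp (hm.comp (measurable_integrator hw ε L n))
  · exact (measurable_const.sub ha).ennreal_ofReal

/-! ### Consequences of moving to a set with probability one -/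

/-- The probability of a transition into `X`, on valid states. -/
def transition (w : Trace → ℝ) (ε : ℝ) (L : ℕ) (X : Set State) : State → ENNReal :=
  (Valid w ε L).indicator fun s => integrateAccept w ε L s X

theorem measurable_transition {w : Trace → ℝ} (hw : Measurable w) (ε : ℝ) (L : ℕ)
    {X : Set State} (hX : MeasurableSet X) : Measurable (transition w ε L X) := by
  have h : ∀ n, Measurable fun s : Phase n => transition w ε L X ⟨n, s⟩ := fun n =>
    (measurable_integrateAccept hw ε L hX n).indicator
      (measurable_sigmaMk (β := Phase) n (measurableSet_valid hw ε L))
  exact fun t ht => measurableSet_sigma fun n => h n ht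

theorem marginalKernel_eq_tsum {w : Trace → ℝ} (hw : Measurable w) (ε : ℝ) (L : ℕ) {n : ℕ}
    (q : Fin n → ℝ) (hq : 0 < w ⟨n, q⟩) (B : Set Trace)
    (hX : MeasurableSet (supported w ⁻¹' B ∩ Valid w ε L)) :
    marginalKernel w ε L ⟨n, q⟩ B = ∑' m, ∫⁻ z, transition w ε L (supported w ⁻¹' B ∩ Valid w ε L)
      ⟨n + m, (Fin.append q z.1, z.2)⟩ ∂((stdNormal m).prod (stdNormal (n + m))) := by
  rw [marginalKernel, if_pos hq, search, lintegral_sum_measure]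
  refine tsum_congr fun m => ?_
  have hm : Measurable fun z : (Fin m → ℝ) × (Fin (n + m) → ℝ) =>
      (⟨n + m, (Fin.append q z.1, z.2)⟩ : State) := by
    refine (measurable_sigmaMk (β := Phase) (n + m)).comp (Measurable.prodMk ?_ measurable_snd)
    exact (measurable_append n m).comp (measurable_const.prodMk measurable_fst)
  rw [← lintegral_indicator (measurableSet_valid hw ε L)]
  exact lintegral_map (measurable_transition hw ε L hX) hm

theorem valid_unique {w : Trace → ℝ} {ε : ℝ} {L n m : ℕ} {x : (ℕ → ℝ) × (ℕ → ℝ)}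
    (h1 : (⟨n, initialState n x⟩ : State) ∈ Valid w ε L)
    (h2 : (⟨m, initialState m x⟩ : State) ∈ Valid w ε L) : n = m := by
  rcases lt_trichotomy n m with h | h | h
  · exact absurd h1.1 (h2.2 n h)
  · exact h
  · exact absurd h2.1 (h1.2 m h)

theorem measurePreserving_append_state (n m : ℕ) :
    MeasurePreserving (fun z : (Fin n → ℝ) × ((Fin m → ℝ) × (Fin (n + m) → ℝ)) =>
      ((Fin.append z.1 z.2.1, z.2.2) : Phase (n + m)))
      ((stdNormal n).prod ((stdNormal m).prod (stdNormal (n + m)))) (phaseNormal (n + m)) := by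
  have h1 := (measurePreserving_append n m).prod (MeasurePreserving.id (stdNormal (n + m)))
  have h2 := measurePreserving_prodAssoc (stdNormal n) (stdNormal m) (stdNormal (n + m))
  exact h1.comp (h2.symm _)

theorem measurable_lintegral_append {n m : ℕ} {F : Phase (n + m) → ENNReal} (hF : Measurable F) :
    Measurable fun q : Fin n → ℝ =>
      ∫⁻ z, F (Fin.append q z.1, z.2) ∂((stdNormal m).prod (stdNormal (n + m))) := by
  have h : Measurable fun z : (Fin n → ℝ) × ((Fin m → ℝ) × (Fin (n + m) → ℝ)) =>
      F (Fin.append z.1 z.2.1, z.2.2) := hF.comp (measurePreserving_append_state n m).measurable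
  exact h.lintegral_prod_right'

theorem lintegral_phaseNormal_add {n m : ℕ} {F : Phase (n + m) → ENNReal} (hF : Measurable F) :
    ∫⁻ s, F s ∂phaseNormal (n + m) = ∫⁻ q, ∫⁻ z, F (Fin.append q z.1, z.2)
      ∂((stdNormal m).prod (stdNormal (n + m))) ∂stdNormal n := by
  have h : Measurable fun z : (Fin n → ℝ) × ((Fin m → ℝ) × (Fin (n + m) → ℝ)) =>
      F (Fin.append z.1 z.2.1, z.2.2) := hF.comp (measurePreserving_append_state n m).measurable
  rw [← (measurePreserving_append_state n m).lintegral_comp hF]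
  exact lintegral_prod _ h.aemeasurable

/-- The kernel is read along one pair of infinite sequences. At most one prefix is valid, so the sum
`f` over dimensions has at most one nonzero term and is at most the indicator `g` of starting in
`B`. The hypothesis makes the two integrals equal, hence `f = g` almost everywhere: the search
terminates and the transition found has probability one. -/
theorem ae_exists_transition_eq_one {w : Trace → ℝ} (h0 : ∀ t, 0 ≤ w t) (ht : TreeRepresentable w)
    (hw : Measurable w) {ε : ℝ} {L : ℕ} {B B' : Set Trace} (hB : MeasurableSet B)
    (hB' : MeasurableSet B') (hQ : ∀ t ∈ B, marginalKernel w ε L t B' = 1) (n : ℕ) :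
    ∀ᵐ x ∂pathNormal, (⟨n, (initialState n x).1⟩ : Trace) ∈ B →
      ∃ m, transition w ε L (supported w ⁻¹' B' ∩ Valid w ε L) ⟨n + m, initialState (n + m) x⟩ = 1 := by
  set X := supported w ⁻¹' B' ∩ Valid w ε L with hXdef
  have hX : MeasurableSet X := measurableSet_supported_inter_valid h0 ht hw ε L hB'
  set F := transition w ε L X with hF
  have hFm : Measurable F := measurable_transition hw ε L hX
  set b : Set (Fin n → ℝ) := {q | (⟨n, q⟩ : Trace) ∈ B} with hb
  have hbm : MeasurableSet b := measurable_sigmaMk n hB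
  have hpos : ∀ q ∈ b, 0 < w ⟨n, q⟩ := by
    intro q hq
    by_contra hcon
    have := hQ _ hq
    rw [marginalKernel, if_neg hcon] at this
    exact zero_ne_one this
  set f : (ℕ → ℝ) × (ℕ → ℝ) → ENNReal := fun x =>
    ∑' m, b.indicator 1 (initialState n x).1 * F ⟨n + m, initialState (n + m) x⟩ with hf
  set g : (ℕ → ℝ) × (ℕ → ℝ) → ENNReal := fun x => b.indicator 1 (initialState n x).1 with hg
  have hgm : Measurable g :=
    (measurable_one.indicator hbm).comp (measurable_fst.comp (measurable_initialState n))
  have hFle : ∀ s, F s ≤ 1 := by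
    intro s
    by_cases hs : s ∈ Valid w ε L
    · rw [hF, transition, Set.indicator_of_mem hs]
      exact integrateAccept_le_one h0 ε L s hX
    · rw [hF, transition, Set.indicator_of_notMem hs]
      exact zero_le_one
  have hFval : ∀ s, F s ≠ 0 → s ∈ Valid w ε L := fun s hs => Set.mem_of_indicator_ne_zero hs
  have hsingle : ∀ x m, F ⟨n + m, initialState (n + m) x⟩ ≠ 0 →
      f x = g x * F ⟨n + m, initialState (n + m) x⟩ := by
    intro x m hm
    refine tsum_eq_single m fun m' hm' => ?_
    by_contra hne
    have h2 := hFval _ (right_ne_zero_of_mul hne)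
    have := valid_unique h2 (hFval _ hm)
    omega
  have hfg : ∀ x, f x ≤ g x := by
    intro x
    by_cases hx : ∃ m, F ⟨n + m, initialState (n + m) x⟩ ≠ 0
    · obtain ⟨m, hm⟩ := hx
      rw [hsingle x m hm]
      exact mul_le_of_le_one_right' (hFle _)
    · push Not at hx
      rw [hf]
      simp [hx]
  have hint : ∫⁻ x, g x ∂pathNormal ≤ ∫⁻ x, f x ∂pathNormal := by
    have e1 : ∫⁻ x, g x ∂pathNormal = ∫⁻ q, b.indicator 1 q ∂stdNormal n :=
      (measurePreserving_fst.comp (measurePreserving_initialState n)).lintegral_comp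
        (measurable_one.indicator hbm)
    have hm1 : ∀ m, Measurable fun s : Phase (n + m) =>
        b.indicator (1 : (Fin n → ℝ) → ENNReal) (pre s.1 (Nat.le_add_right n m)) * F ⟨n + m, s⟩ := fun m =>
      ((measurable_one.indicator hbm).comp ((measurable_pre _).comp measurable_fst)).mul
        (hFm.comp (measurable_sigmaMk (β := Phase) (n + m)))
    have e2 : ∀ m, ∫⁻ x, b.indicator 1 (initialState n x).1 *
        F ⟨n + m, initialState (n + m) x⟩ ∂pathNormal = ∫⁻ q, b.indicator 1 q *
          ∫⁻ z, F ⟨n + m, (Fin.append q z.1, z.2)⟩ ∂((stdNormal m).prod (stdNormal (n + m)))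
            ∂stdNormal n := by
      intro m
      refine ((measurePreserving_initialState (n + m)).lintegral_comp (hm1 m)).trans
        ((lintegral_phaseNormal_add (hm1 m)).trans (lintegral_congr fun q => ?_))
      simp only [pre_append]
      refine lintegral_const_mul _ ?_
      exact (hFm.comp (measurable_sigmaMk (β := Phase) (n + m))).comp
        (((measurable_append n m).comp (measurable_const.prodMk measurable_fst)).prodMk
          measurable_snd)
    have hm4 : ∀ m, Measurable fun q : Fin n → ℝ => b.indicator (1 : (Fin n → ℝ) → ENNReal) q *
          ∫⁻ z, F ⟨n + m, (Fin.append q z.1, z.2)⟩ ∂((stdNormal m).prod (stdNormal (n + m))) := by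
      intro m
      exact (measurable_one.indicator hbm).mul
        (measurable_lintegral_append (hFm.comp (measurable_sigmaMk (β := Phase) (n + m))))
    have e3 : ∫⁻ x, f x ∂pathNormal = ∑' m, ∫⁻ x, b.indicator 1 (initialState n x).1 *
        F ⟨n + m, initialState (n + m) x⟩ ∂pathNormal :=
      lintegral_tsum fun m => ((hm1 m).comp (measurable_initialState (n + m))).aemeasurable
    rw [e3, tsum_congr e2, ← lintegral_tsum fun m => (hm4 m).aemeasurable, e1]
    refine lintegral_mono fun q => ?_
    by_cases hq : q ∈ b
    · simp only [Set.indicator_of_mem hq, Pi.one_apply, one_mul]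
      rw [← marginalKernel_eq_tsum hw ε L q (hpos q hq) B' hX, hQ _ hq]
    · simp [hq]
  have hfin : ∫⁻ x, f x ∂pathNormal ≠ ⊤ := by
    refine ne_top_of_le_ne_top (b := 1) ENNReal.one_ne_top ?_
    calc ∫⁻ x, f x ∂pathNormal ≤ ∫⁻ _, 1 ∂pathNormal :=
          lintegral_mono fun x => (hfg x).trans (Set.indicator_le_self' (fun _ _ => zero_le) _)
      _ = 1 := by simp
  filter_upwards [ae_eq_of_ae_le_of_lintegral_le (Filter.Eventually.of_forall hfg) hfin
    hgm.aemeasurable hint] with x hx hxb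
  have hg1 : g x = 1 := Set.indicator_of_mem (s := b) hxb 1
  rw [hg1] at hx
  by_cases hx' : ∃ m, F ⟨n + m, initialState (n + m) x⟩ ≠ 0
  · obtain ⟨m, hm⟩ := hx'
    have := hsingle x m hm
    rw [hx, hg1, one_mul] at this
    exact ⟨m, this.symm⟩
  · push Not at hx'
    rw [hf] at hx
    simp [hx'] at hx

/-- A valid state of a chain that moves to `B'` with probability one is accepted. -/
theorem accept_of_transition_eq_one {w : Trace → ℝ} {ε : ℝ} {L : ℕ} {B B' : Set Trace}
    (hX : MeasurableSet (supported w ⁻¹' B' ∩ Valid w ε L)) (hBB' : Disjoint B B') {s : State}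
    (hs : supported w s ∈ B)
    (h : transition w ε L (supported w ⁻¹' B' ∩ Valid w ε L) s = 1) :
    accept w ε L s = 1 ∧ (⟨s.1, integrator w ε L s.1 s.2⟩ : State) ∈ Valid w ε L ∧
      supported w ⟨s.1, integrator w ε L s.1 s.2⟩ ∈ B' := by
  have hv : s ∈ Valid w ε L := Set.mem_of_indicator_ne_zero (by
    rw [transition] at h; rw [h]; exact one_ne_zero)
  have hnot : s ∉ supported w ⁻¹' B' ∩ Valid w ε L := fun hmem =>
    Set.disjoint_left.1 hBB' hs hmem.1
  rw [transition, Set.indicator_of_mem hv, integrateAccept_apply w ε L s hX,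
    Set.indicator_of_notMem hnot, mul_zero, add_zero] at h
  by_cases hmem : (⟨s.1, integrator w ε L s.1 s.2⟩ : State) ∈ supported w ⁻¹' B' ∩ Valid w ε L
  · rw [Set.indicator_of_mem hmem, Pi.one_apply, mul_one, ENNReal.ofReal_eq_one] at h
    exact ⟨h, hmem.2, hmem.1⟩
  · rw [Set.indicator_of_notMem hmem, mul_zero] at h
    exact absurd h zero_ne_one

theorem pos_of_marginalKernel_eq_one {w : Trace → ℝ} {ε : ℝ} {L : ℕ} {t : Trace} {B : Set Trace}
    (h : marginalKernel w ε L t B = 1) : 0 < w t := by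
  by_contra hcon
  rw [marginalKernel, if_neg hcon] at h
  exact zero_ne_one h

theorem mem_valid_of_transition_eq_one {w : Trace → ℝ} {ε : ℝ} {L : ℕ} {X : Set State} {s : State}
    (h : transition w ε L X s = 1) : s ∈ Valid w ε L :=
  Set.mem_of_indicator_ne_zero (by rw [transition] at h; rw [h]; exact one_ne_zero)

theorem ae_exists_mem_valid {w : Trace → ℝ} (h0 : ∀ t, 0 ≤ w t) (ht : TreeRepresentable w)
    (hw : Measurable w) {ε : ℝ} {L : ℕ} {B B' : Set Trace} (hB : MeasurableSet B)
    (hB' : MeasurableSet B') (hQ : ∀ t ∈ B, marginalKernel w ε L t B' = 1) (n : ℕ) :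
    ∀ᵐ x ∂pathNormal, (⟨n, (initialState n x).1⟩ : Trace) ∈ B →
      ∃ m, (⟨m, initialState m x⟩ : State) ∈ Valid w ε L := by
  filter_upwards [ae_exists_transition_eq_one h0 ht hw hB hB' hQ n] with x hx hxB
  obtain ⟨m, hm⟩ := hx hxB
  exact ⟨_, mem_valid_of_transition_eq_one hm⟩

/-- By `valid_unique`, a valid state above `B` is the one at which the search stops. A rejection
there would leave the chain in `B`, which is disjoint from `B'`. -/
theorem ae_accept_eq_one {w : Trace → ℝ} (h0 : ∀ t, 0 ≤ w t) (ht : TreeRepresentable w)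
    (hw : Measurable w) {ε : ℝ} {L : ℕ} {B B' : Set Trace} (hB : MeasurableSet B)
    (hB' : MeasurableSet B') (hBB' : Disjoint B B')
    (hQ : ∀ t ∈ B, marginalKernel w ε L t B' = 1) {n N : ℕ} (hn : n ≤ N) :
    ∀ᵐ s ∂phaseNormal N, (⟨n, pre s.1 hn⟩ : Trace) ∈ B → (⟨N, s⟩ : State) ∈ Valid w ε L →
      accept w ε L ⟨N, s⟩ = 1 ∧ (⟨N, integrator w ε L N s⟩ : State) ∈ Valid w ε L ∧
        supported w ⟨N, integrator w ε L N s⟩ ∈ B' := by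
  have hX := measurableSet_supported_inter_valid h0 ht hw ε L hB'
  have hm := measurable_sigmaMk (β := Phase) N
  have h : ∀ᵐ s ∂phaseNormal N, (⟨n, pre s.1 hn⟩ : Trace) ∈ B → (⟨N, s⟩ : State) ∈ Valid w ε L →
      transition w ε L (supported w ⁻¹' B' ∩ Valid w ε L) ⟨N, s⟩ = 1 := by
    rw [← (measurePreserving_initialState N).map_eq,
      ae_map_iff (measurable_initialState N).aemeasurable]
    · filter_upwards [ae_exists_transition_eq_one h0 ht hw hB hB' hQ n] with x hx hxB hv
      obtain ⟨m, h1⟩ := hx hxB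
      obtain rfl := valid_unique hv (mem_valid_of_transition_eq_one h1)
      exact h1
    · have h1 : MeasurableSet {s : Phase N | (⟨n, pre s.1 hn⟩ : Trace) ∈ B} :=
        (measurable_sigmaMk (β := fun n => Fin n → ℝ) n).comp
          ((measurable_pre hn).comp measurable_fst) hB
      have h2 : MeasurableSet {s : Phase N | (⟨N, s⟩ : State) ∈ Valid w ε L} :=
        hm (measurableSet_valid hw ε L)
      have h3 : MeasurableSet {s : Phase N |
          transition w ε L (supported w ⁻¹' B' ∩ Valid w ε L) ⟨N, s⟩ = 1} :=
        ((measurable_transition hw ε L hX).comp hm) (measurableSet_singleton 1)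
      exact h1.imp (h2.imp h3)
  filter_upwards [h] with s hs hsB hv
  refine accept_of_transition_eq_one hX hBB' (s := ⟨N, s⟩) ?_ (hs hsB hv)
  rw [supported_eq ht s hn (pos_of_marginalKernel_eq_one (hQ _ hsB))]
  exact hsB

theorem le_of_accept_eq_one {w : Trace → ℝ} {ε : ℝ} {L N : ℕ} {s : Phase N}
    (hs : 0 < trunc w N s.1) (h : accept w ε L ⟨N, s⟩ = 1) :
    trunc w N s.1 * normalDensity s ≤
      trunc w N (integrator w ε L N s).1 * normalDensity (integrator w ε L N s) := by
  have h1 : (1 : ℝ) ≤ (trunc w N (integrator w ε L N s).1 * normalDensity (integrator w ε L N s)) /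
      (trunc w N s.1 * normalDensity s) := h ▸ min_le_right _ _
  exact (one_le_div (mul_pos hs (normalDensity_pos s))).1 h1

/-- If the chain moves from `B₀` to `B₁` and from there to `B₂` with probability one, then the
integrator conserves the energy exactly, along almost all trajectories that start in `B₀`. -/
theorem ae_conserved {w : Trace → ℝ} (h0 : ∀ t, 0 ≤ w t) (ht : TreeRepresentable w)
    (hw : Measurable w) {ε : ℝ} {L : ℕ} {B₀ B₁ B₂ : Set Trace} (hB₀ : MeasurableSet B₀)
    (hB₁ : MeasurableSet B₁) (hB₂ : MeasurableSet B₂) (h01 : Disjoint B₀ B₁)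
    (h12 : Disjoint B₁ B₂) (hQ₀ : ∀ t ∈ B₀, marginalKernel w ε L t B₁ = 1)
    (hQ₁ : ∀ t ∈ B₁, marginalKernel w ε L t B₂ = 1) {n N : ℕ} (hn : n ≤ N) :
    ∀ᵐ s ∂phaseNormal N, (⟨n, pre s.1 hn⟩ : Trace) ∈ B₀ → (⟨N, s⟩ : State) ∈ Valid w ε L →
      trunc w N (integrator w ε L N s).1 * normalDensity (integrator w ε L N s) =
        trunc w N s.1 * normalDensity s := by
  -- The length of the supported prefix of `Ψ s` varies with `s`, so all lengths are treated at
  -- once.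
  have h1 : ∀ k : ℕ, ∀ᵐ s ∂phaseNormal N, ∀ hk : k ≤ N,
      (⟨k, pre (integrator w ε L N s).1 hk⟩ : Trace) ∈ B₁ →
      (⟨N, integrator w ε L N s⟩ : State) ∈ Valid w ε L →
      accept w ε L ⟨N, integrator w ε L N s⟩ = 1 := by
    intro k
    by_cases hk : k ≤ N
    · filter_upwards [(quasiMeasurePreserving_integrator hw ε L N).ae
        (ae_accept_eq_one h0 ht hw hB₁ hB₂ h12 hQ₁ hk)] with s hs _ h1 h2
      exact (hs h1 h2).1
    · exact Filter.Eventually.of_forall fun s hk' => absurd hk' hk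
  filter_upwards [ae_all_iff.2 h1, ae_accept_eq_one h0 ht hw hB₀ hB₁ h01 hQ₀ hn] with s hs1 hs2 hsB hv
  obtain ⟨ha, hv', hf⟩ := hs2 hsB hv
  obtain ⟨k, hk, _, he⟩ := exists_supported_eq h0 ht (trunc_pos_of_mem_valid hv')
  rw [he] at hf
  have h3 := le_of_accept_eq_one (trunc_pos_of_mem_valid hv') (hs1 k hk hf hv')
  rw [integrator_integrator] at h3
  exact le_antisymm h3 (le_of_accept_eq_one (trunc_pos_of_mem_valid hv) ha)

/-! ### Energy cannot be conserved along almost all trajectories -/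

/-- A bound for the force that holds in all dimensions. -/
def IsForceBound (w : Trace → ℝ) (A : Set Trace) (M : ℝ) : Prop :=
  0 ≤ M ∧ ∀ (n : ℕ), ∀ q ∈ regularPoints w A n, ∀ i, |gradU w n q i| ≤ M

theorem ConvergenceAssumptions.exists_isForceBound {w : Trace → ℝ} {A : Set Trace}
    (hA : ConvergenceAssumptions w A) : ∃ M, IsForceBound w A M := by
  obtain ⟨M₁, M₂, h⟩ := hA.grad_bounded
  refine ⟨max |M₁| |M₂|, (abs_nonneg _).trans (le_max_left _ _), fun n q hq i => ?_⟩
  rw [gradU, abs_neg]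
  exact abs_le_max_abs_abs (h n q hq i).1 (h n q hq i).2

theorem ConvergenceAssumptions.exists_lipschitzOnWith_gradU {w : Trace → ℝ} {A : Set Trace}
    (hA : ConvergenceAssumptions w A) (n : ℕ) :
    ∃ K : NNReal, LipschitzOnWith K (gradU w n) (regularPoints w A n) := by
  obtain ⟨K, hK⟩ := hA.grad_lipschitz n
  exact ⟨K, hK.neg⟩

/-- The states in dimension `m` with initial position in `b` that leave the domain in step `j`. -/
def leavingStates (w : Trace → ℝ) (ε : ℝ) {n m : ℕ} (hnm : n ≤ m) (b : Set (Fin n → ℝ)) (j : ℕ) :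
    Set (Phase m) :=
  {t | pre t.1 hnm ∈ b ∧ (∀ l < j, 0 < trunc w m ((leapfrog w ε m)^[l] t).1) ∧
    ¬ 0 < trunc w m ((leapfrog w ε m)^[j] t).1}

theorem measurableSet_leavingStates {w : Trace → ℝ} (hw : Measurable w) (ε : ℝ) {n m : ℕ}
    (hnm : n ≤ m) {b : Set (Fin n → ℝ)} (hb : MeasurableSet b) (j : ℕ) :
    MeasurableSet (leavingStates w ε hnm b j) := by
  have h : ∀ l : ℕ, MeasurableSet {t : Phase m | 0 < trunc w m ((leapfrog w ε m)^[l] t).1} :=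
    fun l => measurableSet_lt measurable_const ((measurable_trunc hw m).comp
      (measurable_fst.comp ((measurable_leapfrog hw ε m).iterate l)))
  have e : leavingStates w ε hnm b j = (fun t : Phase m => pre t.1 hnm) ⁻¹' b ∩
      ((⋂ l, ⋂ _ : l < j, {t | 0 < trunc w m ((leapfrog w ε m)^[l] t).1}) ∩
        {t | 0 < trunc w m ((leapfrog w ε m)^[j] t).1}ᶜ) := by
    ext t; simp [leavingStates]
  rw [e]
  exact (((measurable_pre hnm).comp measurable_fst) hb).inter
    ((MeasurableSet.iInter fun l => MeasurableSet.iInter fun _ => h l).inter (h j).compl)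

theorem staysInDomain_of_notMem_leavingStates {w : Trace → ℝ} {ε : ℝ} {L n m : ℕ} {hnm : n ≤ m}
    {b : Set (Fin n → ℝ)} {t : Phase m} (ht : pre t.1 hnm ∈ b)
    (h : ∀ j ≤ L, t ∉ leavingStates w ε hnm b j) : StaysInDomain w ε L m t := by
  intro l
  induction l using Nat.strong_induction_on with
  | _ l ih =>
    intro hl
    by_contra hcon
    exact h l hl ⟨ht, fun l' hl' => ih l' hl' (by omega), hcon⟩

/-- Energy is not conserved along almost all of the trajectories starting on a line. -/
theorem not_ae_valid_on_pivot {w : Trace → ℝ} (hw : StandingAssumptions w) {A : Set Trace}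
    (hA : ConvergenceAssumptions w A) {M : ℝ} (hM : IsForceBound w A M) {ε : ℝ} (hε : 0 < ε)
    {L j : ℕ} (hL : 1 ≤ L) (hj : j ≤ L) {n N : ℕ} (hn : n ≤ N) (i : Fin N) (s : Phase N)
    (hs : 0 < w ⟨n, pre s.1 hn⟩)
    (hfar : L ≤ 2 * j → L * (L + 1) * (ε * ε * M) + L * M + 1 < |s.1 i + j * ε * s.2 i|)
    (hpre : ∀ a, pre (pivot ε j i s a).1 hn = pre s.1 hn)
    (hgood : ∀ᵐ a : ℝ, pivot ε j i s a ∈ goodStates w A ε L N)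
    (hv : ∀ᵐ a : ℝ, StaysInDomain w ε L N (pivot ε j i s a) ∧
      trunc w N (integrator w ε L N (pivot ε j i s a)).1 *
        normalDensity (integrator w ε L N (pivot ε j i s a)) =
          trunc w N (pivot ε j i s a).1 * normalDensity (pivot ε j i s a)) : False := by
  obtain ⟨c₀, hc₀, hc⟩ := hA.bounded_below
  obtain ⟨K, hK⟩ := hA.exists_lipschitzOnWith_gradU N
  -- The constant `τ` is the value of `w` on the prefix of length `n`, which does not vary along the
  -- line.
  refine not_ae_conserved_on_pivot hw.nonneg hw.tree hc₀ hc hM.1 (hM.2 N) hK hε hL hj i s hs hfar ?_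
  filter_upwards [hgood, hv] with a h1 h2
  refine ⟨fun l hl => mem_regularPoints hA.differentiableAt (h1 l hl) (h2.1 l hl), ?_⟩
  rw [h2.2, trunc_eq_of_pos hw.nonneg hw.tree hn (by rw [hpre]; exact hs), hpre]

/-- The states whose prefix of length `m` leaves the domain in step `j`, whereas the state itself is
the shortest extension whose position in step `j` is in the domain, and whose coordinate `m` is
then far from the origin. -/
def farStates (w : Trace → ℝ) (ε : ℝ) {n m N : ℕ} (hnm : n ≤ m) (hmN : m < N)
    (b : Set (Fin n → ℝ)) (j : ℕ) (C : ℝ) : Set (Phase N) :=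
  {s | preS s hmN.le ∈ leavingStates w ε hnm b j ∧
    C < |s.1 ⟨m, hmN⟩ + j * ε * s.2 ⟨m, hmN⟩| ∧ 0 < trunc w N ((leapfrog w ε N)^[j] s).1 ∧
    ∀ (k : ℕ) (hk : k < N), ¬ 0 < trunc w k (pre ((leapfrog w ε N)^[j] s).1 hk.le)}

/-- Through almost every far state, the line that pivots coordinate `m` at step `j` consists almost
entirely of valid states: the position at step `j` is fixed, which also keeps shorter prefixes
invalid, and `hmax` excludes leaving later. Conservation along such a line is impossible. -/
theorem ae_notMem_farStates {w : Trace → ℝ} (hw : StandingAssumptions w) {A : Set Trace}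
    (hA : ConvergenceAssumptions w A) {M : ℝ} (hM : IsForceBound w A M) {ε : ℝ} (hε : 0 < ε)
    {L j : ℕ} (hL : 1 ≤ L) (hj : j ≤ L) {n m N : ℕ} (hnm : n ≤ m) (hmN : m < N)
    {b : Set (Fin n → ℝ)} (hb : ∀ q ∈ b, 0 < w ⟨n, q⟩)
    (hE : ∀ᵐ s ∂phaseNormal N, pre s.1 (hnm.trans hmN.le) ∈ b → (⟨N, s⟩ : State) ∈ Valid w ε L →
      trunc w N (integrator w ε L N s).1 * normalDensity (integrator w ε L N s) =
        trunc w N s.1 * normalDensity s)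
    (hmax : ∀ j', j < j' → j' ≤ L →
      phaseNormal N (leavingStates w ε (hnm.trans hmN.le) b j') = 0) :
    ∀ᵐ s ∂phaseNormal N, s ∉ farStates w ε hnm hmN b j
      (L * (L + 1) * (ε * ε * M) + L * M + 1) := by
  have hgood := ae_mem_goodStates hw.measurable hA.conull ε L N
  have hmax' : ∀ᵐ s ∂phaseNormal N, ∀ j', j < j' → j' ≤ L →
      s ∉ leavingStates w ε (hnm.trans hmN.le) b j' := by
    refine ae_all_iff.2 fun j' => ?_
    by_cases h : j < j' ∧ j' ≤ L
    · filter_upwards [measure_eq_zero_iff_ae_notMem.1 (hmax j' h.1 h.2)] with s hs _ _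
      exact hs
    · exact Filter.Eventually.of_forall fun s h1 h2 => absurd ⟨h1, h2⟩ h
  set i : Fin N := ⟨m, hmN⟩ with hi
  filter_upwards [hgood, ae_ae_pivot hgood ε j i, ae_ae_pivot hE ε j i,
    ae_ae_pivot hmax' ε j i] with s hs hs1 hs2 hs3 hfar
  obtain ⟨⟨hsb, hstay, hleave⟩, hfar, hpos, hmin⟩ := hfar
  have hpre : ∀ (k : ℕ) (hk : k ≤ m) a,
      pre (pivot ε j i s a).1 (hk.trans hmN.le) = pre s.1 (hk.trans hmN.le) := by
    intro k hk a
    rw [pivot, pre_add, pre_single_of_le _ i hk, add_zero]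
  have hcons := pre_leapfrog_iterate hw.nonneg hw.tree hA.differentiableAt hmN.le hj hs hstay
  refine not_ae_valid_on_pivot hw hA hM hε hL hj (hnm.trans hmN.le) i s (hb _ hsb)
    (fun _ => hfar) (hpre n hnm) hs1 ?_
  filter_upwards [hs1, hs2, hs3] with a ha1 ha2 ha3
  have hshear := leapfrog_iterate_shear hw.nonneg hw.tree hA.differentiableAt hmN.le hj hs ha1
    (i := i) le_rfl (α := -(j * a)) (β := a / ε) rfl rfl
    (fun l hl => (hcons l hl.le).1 ▸ hstay l hl)
  have hj_eq : ((leapfrog w ε N)^[j] (pivot ε j i s a)).1 = ((leapfrog w ε N)^[j] s).1 := by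
    rw [(hshear j le_rfl).1]
    have : -((j : ℝ) * a) + j * ε * (a / ε) = 0 := by field_simp; ring
    rw [this, Pi.single_zero, add_zero]
  have hab : pre (pivot ε j i s a).1 (hnm.trans hmN.le) ∈ b := by rw [hpre n hnm]; exact hsb
  have hdom : StaysInDomain w ε L N (pivot ε j i s a) := by
    refine staysInDomain_of_notMem_leavingStates hab fun j' hj' => ?_
    rcases lt_trichotomy j' j with h | h | h
    · refine fun hmem => hmem.2.2 (trunc_pos_of_pre hw.nonneg hmN.le ?_)
      rw [(hshear j' h.le).1, pre_add, pre_single_of_le _ i le_rfl, add_zero, (hcons j' h.le).1]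
      exact hstay j' h
    · subst h
      exact fun hmem => hmem.2.2 (hj_eq ▸ hpos)
    · exact ha3 j' h hj'
  have hvalid : (⟨N, pivot ε j i s a⟩ : State) ∈ Valid w ε L := by
    refine ⟨hdom, fun k hk hstay' => hmin k hk ?_⟩
    rw [← hj_eq, (pre_leapfrog_iterate hw.nonneg hw.tree hA.differentiableAt hk.le hj ha1
      (fun l hl => hstay' l (hl.le.trans hj)) j le_rfl).1]
    exact hstay' j hj
  exact ⟨hdom, ha2 hab hvalid⟩

/-- A state that leaves the domain before it is extended to a valid one has an extension, in some
dimension, that is the shortest with a position in the domain at the time of leaving. -/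
theorem exists_shortest_extension {w : Trace → ℝ} (hw : StandingAssumptions w) {A : Set Trace}
    (hA : ConvergenceAssumptions w A) {ε : ℝ} {L j : ℕ} (hj : j ≤ L) {n m N : ℕ} {hnm : n ≤ m}
    {b : Set (Fin n → ℝ)} {x : (ℕ → ℝ) × (ℕ → ℝ)}
    (hgood : ∀ k, initialState k x ∈ goodStates w A ε L k)
    (hm : initialState m x ∈ leavingStates w ε hnm b j)
    (hN : StaysInDomain w ε L N (initialState N x)) :
    ∃ k, m < k ∧ 0 < trunc w k ((leapfrog w ε k)^[j] (initialState k x)).1 ∧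
      ∀ (k' : ℕ) (hk' : k' < k),
        ¬ 0 < trunc w k' (pre ((leapfrog w ε k)^[j] (initialState k x)).1 hk'.le) := by
  classical
  obtain ⟨_, hstay, hleave⟩ := hm
  have hcons : ∀ {k l : ℕ} (h : k ≤ l),
      (∀ u < j, 0 < trunc w k ((leapfrog w ε k)^[u] (initialState k x)).1) →
      ∀ u ≤ j, pre ((leapfrog w ε l)^[u] (initialState l x)).1 h =
        ((leapfrog w ε k)^[u] (initialState k x)).1 := fun h hu u huj =>
    (pre_leapfrog_iterate hw.nonneg hw.tree hA.differentiableAt h hj (hgood _) hu u huj).1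
  have hup : ∀ {k : ℕ}, m ≤ k →
      ∀ u < j, 0 < trunc w k ((leapfrog w ε k)^[u] (initialState k x)).1 := by
    intro k hk u hu
    refine trunc_pos_of_pre hw.nonneg hk ?_
    rw [hcons hk hstay u hu.le]
    exact hstay u hu
  have hmN : m < N := by
    by_contra hcon
    refine hleave (trunc_pos_of_pre hw.nonneg (not_lt.1 hcon) ?_)
    rw [hcons (not_lt.1 hcon) (fun u hu => hN u (hu.le.trans hj)) j le_rfl]
    exact hN j hj
  have hex : ∃ k, m < k ∧ 0 < trunc w k ((leapfrog w ε k)^[j] (initialState k x)).1 :=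
    ⟨N, hmN, hN j hj⟩
  obtain ⟨h1, h2⟩ := Nat.find_spec hex
  refine ⟨Nat.find hex, h1, h2, fun k' hk' hpos => ?_⟩
  -- A prefix of length at most `m` in the domain would bring dimension `m` back into it at step
  -- `j`; for longer ones the minimality of `Nat.find` applies.
  rcases le_or_gt k' m with h | h
  · refine hleave ?_
    rw [← hcons h1.le hstay j le_rfl]
    exact trunc_pos_of_pre hw.nonneg h hpos
  · refine Nat.find_min hex hk' ⟨h, ?_⟩
    rwa [hcons hk'.le (hup h.le) j le_rfl] at hpos

/-- If all far extensions of leaving states are negligible, so are the leaving states. -/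
theorem measure_leavingStates_eq_zero {w : Trace → ℝ} (hw : StandingAssumptions w) {A : Set Trace}
    (hA : ConvergenceAssumptions w A) {ε : ℝ} {L j : ℕ} (hj : j ≤ L) {n m : ℕ} (hnm : n ≤ m)
    {b : Set (Fin n → ℝ)} (hb : MeasurableSet b) {C : ℝ}
    (hT : ∀ᵐ x ∂pathNormal, (initialState n x).1 ∈ b →
      ∃ N, (⟨N, initialState N x⟩ : State) ∈ Valid w ε L)
    (hfar : ∀ (N : ℕ) (hmN : m < N), ∀ᵐ s ∂phaseNormal N, s ∉ farStates w ε hnm hmN b j C) :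
    phaseNormal m (leavingStates w ε hnm b j) = 0 := by
  have hm : m ≤ m + 1 := Nat.le_succ m
  set i : Fin (m + 1) := Fin.last m with hi
  have hlm := measurableSet_leavingStates hw.measurable ε hnm hb j
  have hgood : ∀ᵐ x ∂pathNormal, ∀ k, initialState k x ∈ goodStates w A ε L k :=
    ae_all_iff.2 fun k => (measurePreserving_initialState k).quasiMeasurePreserving.ae
      (ae_mem_goodStates hw.measurable hA.conull ε L k)
  have hfar' : ∀ᵐ x ∂pathNormal, ∀ (N : ℕ) (hmN : m < N),
      initialState N x ∉ farStates w ε hnm hmN b j C := by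
    refine ae_all_iff.2 fun N => ?_
    by_cases hmN : m < N
    · filter_upwards [(measurePreserving_initialState N).quasiMeasurePreserving.ae
        (hfar N hmN)] with x hx _
      exact hx
    · exact Filter.Eventually.of_forall fun x h => absurd h hmN
  -- A leaving state has a shortest extension that is in the domain at step `j`; as far ones are
  -- negligible, its first new coordinate is near the origin.
  have hnear : ∀ᵐ t ∂phaseNormal (m + 1), preS t hm ∈ leavingStates w ε hnm b j →
      |t.1 i + j * ε * t.2 i| ≤ C := by
    rw [← (measurePreserving_initialState (m + 1)).map_eq,
      ae_map_iff (measurable_initialState (m + 1)).aemeasurable]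
    · filter_upwards [hT, hgood, hfar'] with x h1 h2 h3 h4
      obtain ⟨N, hN⟩ := h1 h4.1
      obtain ⟨k, hmk, hpos, hmin⟩ := exists_shortest_extension hw hA hj h2 h4 hN.1
      by_contra hcon
      exact h3 k hmk ⟨h4, not_le.1 hcon, hpos, hmin⟩
    · refine MeasurableSet.imp (measurable_preS hm hlm) (measurableSet_le ?_ measurable_const)
      fun_prop
  -- A shift by more than the length `2 C` of `[-C, C]` in a coordinate on which leaving in
  -- dimension `m` does not depend: a state and its translate cannot both be near.
  set v : Phase (m + 1) := (Pi.single i (2 * C + 1), 0) with hv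
  have hnot : ∀ᵐ t ∂phaseNormal (m + 1), preS t hm ∉ leavingStates w ε hnm b j := by
    filter_upwards [hnear, (quasiMeasurePreserving_add v).ae hnear] with t h1 h2 h3
    have e : preS (t + v) hm = preS t hm := by
      refine Prod.ext ?_ (add_zero _)
      change pre (t.1 + Pi.single i (2 * C + 1)) hm = pre t.1 hm
      rw [pre_add, pre_single_of_le hm i le_rfl, add_zero]
    have h4 := h1 h3
    have h5 := h2 (e ▸ h3)
    have e1 : (t + v).1 i = t.1 i + (2 * C + 1) := by simp [hv]
    have e2 : (t + v).2 i = t.2 i := by simp [hv]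
    rw [e1, e2, abs_le] at h5
    rw [abs_le] at h4
    linarith [h4.1, h5.2]
  rw [← (measurePreserving_preS hm).measure_preimage hlm.nullMeasurableSet]
  exact measure_eq_zero_iff_ae_notMem.2 hnot

/-- A terminating search and exact conservation of energy exclude each other. -/
theorem not_ae_conserved {w : Trace → ℝ} (hw : StandingAssumptions w) {A : Set Trace}
    (hA : ConvergenceAssumptions w A) {ε : ℝ} (hε : 0 < ε) {L : ℕ} (hL : 1 ≤ L) {n : ℕ}
    (hn : 0 < n) {b : Set (Fin n → ℝ)} (hbm : MeasurableSet b) (hb : ∀ q ∈ b, 0 < w ⟨n, q⟩)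
    (hb0 : stdNormal n b ≠ 0)
    (hT : ∀ᵐ x ∂pathNormal, (initialState n x).1 ∈ b →
      ∃ N, (⟨N, initialState N x⟩ : State) ∈ Valid w ε L)
    (hE : ∀ (N : ℕ) (hN : n ≤ N), ∀ᵐ s ∂phaseNormal N, pre s.1 hN ∈ b →
      (⟨N, s⟩ : State) ∈ Valid w ε L →
      trunc w N (integrator w ε L N s).1 * normalDensity (integrator w ε L N s) =
        trunc w N s.1 * normalDensity s) : False := by
  classical
  obtain ⟨M, hM⟩ := hA.exists_isForceBound
  have hleave : ∀ j ≤ L, ∀ (m : ℕ) (hnm : n ≤ m), phaseNormal m (leavingStates w ε hnm b j) = 0 := by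
    by_contra hcon
    push Not at hcon
    set P : ℕ → Prop := fun j =>
      ∃ (m : ℕ) (hnm : n ≤ m), phaseNormal m (leavingStates w ε hnm b j) ≠ 0 with hP
    obtain ⟨j₀, hj₀, hP₀⟩ := hcon
    -- The last step at which leaving has positive probability in some dimension; at later steps it
    -- is negligible in every dimension.
    obtain ⟨m, hnm, hne⟩ : P (Nat.findGreatest P L) := Nat.findGreatest_spec hj₀ hP₀
    set j := Nat.findGreatest P L with hjdef
    have hj : j ≤ L := Nat.findGreatest_le L
    refine hne (measure_leavingStates_eq_zero hw hA hj hnm hbm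
      (C := L * (L + 1) * (ε * ε * M) + L * M + 1) hT fun N hmN => ?_)
    refine ae_notMem_farStates hw hA hM hε hL hj hnm hmN hb (hE N _) fun j' hj' hj'L => ?_
    by_contra hne'
    exact Nat.findGreatest_is_greatest hj' hj'L ⟨N, _, hne'⟩
  set i : Fin n := ⟨0, hn⟩
  have hgood := ae_mem_goodStates hw.measurable hA.conull ε L n
  have hstay : ∀ᵐ s ∂phaseNormal n, ∀ j ≤ L, s ∉ leavingStates w ε le_rfl b j :=
    ae_all_iff.2 fun j => by
      by_cases hj : j ≤ L
      · filter_upwards [measure_eq_zero_iff_ae_notMem.1 (hleave j hj n le_rfl)] with s hs _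
        exact hs
      · exact Filter.Eventually.of_forall fun s h => absurd h hj
  -- With `j = 0` the line varies only the momentum, so it stays above `b`, and no far condition
  -- arises since `L ≤ 0` is excluded.
  have hnot : ∀ᵐ s ∂phaseNormal n, s.1 ∉ b := by
    filter_upwards [ae_ae_pivot hgood ε 0 i, ae_ae_pivot hstay ε 0 i,
      ae_ae_pivot (hE n le_rfl) ε 0 i] with s h1 h2 h3 hsb
    have hfst : ∀ a, (pivot ε 0 i s a).1 = s.1 := fun a => by simp [pivot]
    have hmem : ∀ a, (pivot ε 0 i s a).1 ∈ b := fun a => by rw [hfst]; exact hsb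
    refine not_ae_valid_on_pivot hw hA hM hε hL (Nat.zero_le L) le_rfl i s (hb _ hsb)
      (fun h => by omega) (fun a => hfst a) h1 ?_
    filter_upwards [h2, h3] with a ha2 ha3
    have hdom : StaysInDomain w ε L n (pivot ε 0 i s a) :=
      staysInDomain_of_notMem_leavingStates (hnm := le_rfl) (hmem a) ha2
    refine ⟨hdom, ha3 (hmem a) ⟨hdom, fun k hk hk' => ?_⟩⟩
    exact not_trunc_pos_of_pos hw.nonneg hw.tree (hb _ (hmem a)) hk (hk' 0 (Nat.zero_le L))
  refine hb0 ?_
  rw [← (measurePreserving_fst (μ := stdNormal n) (ν := stdNormal n)).measure_preimage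
    hbm.nullMeasurableSet]
  exact measure_eq_zero_iff_ae_notMem.2 hnot

theorem exists_stdNormal_ne_zero {w : Trace → ℝ} {B : Set Trace} (hB : MeasurableSet B)
    (h : 0 < target w B) : ∃ n, stdNormal n {q | (⟨n, q⟩ : Trace) ∈ B} ≠ 0 := by
  have h1 : target w ≪ traceMeasure :=
    (withDensity_absolutelyContinuous _ _).smul_left _
  by_contra hcon
  push Not at hcon
  refine h.ne' (h1 ?_)
  rw [traceMeasure, Measure.sum_apply _ hB]
  refine ENNReal.tsum_eq_zero.2 fun n => ?_
  rw [Measure.map_apply (measurable_sigmaMk (β := fun n => Fin n → ℝ) n) hB]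
  exact hcon n

/-- The empty trace, if it is supported, is the only point of its chain. -/
theorem not_mem_of_marginalKernel_eq_one {w : Trace → ℝ} (h0 : ∀ t, 0 ≤ w t)
    (ht : TreeRepresentable w) (hw : Measurable w) {ε : ℝ} {L : ℕ} {B B' : Set Trace}
    (hB : MeasurableSet B) (hB' : MeasurableSet B') (hBB' : Disjoint B B')
    (hQ : ∀ t ∈ B, marginalKernel w ε L t B' = 1) (q : Fin 0 → ℝ) : (⟨0, q⟩ : Trace) ∉ B := by
  intro hq
  have hpos := pos_of_marginalKernel_eq_one (hQ _ hq)
  have : IsProbabilityMeasure (phaseNormal 0) := Measure.prod.instIsProbabilityMeasure _ _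
  have : Filter.NeBot (ae (phaseNormal 0)) := ae_neBot.2 (IsProbabilityMeasure.ne_zero _)
  obtain ⟨s, hs⟩ := (ae_accept_eq_one h0 ht hw hB hB' hBB' hQ (le_refl 0)).exists
  have e1 : ∀ q' : Fin 0 → ℝ, q' = q := fun q' => Subsingleton.elim _ _
  have hsB : (⟨0, pre s.1 (le_refl 0)⟩ : Trace) ∈ B := by rw [e1 (pre _ _)]; exact hq
  have hv : (⟨0, s⟩ : State) ∈ Valid w ε L := by
    refine ⟨fun j _ => (trunc_pos_iff h0).2 ⟨0, le_rfl, ?_⟩, fun k hk => absurd hk (Nat.not_lt_zero k)⟩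
    rw [e1 (pre _ _)]
    exact hpos
  obtain ⟨-, -, h3⟩ := hs hsB hv
  rw [supported_eq ht (integrator w ε L 0 s) le_rfl (by rw [e1 (pre _ _)]; exact hpos),
    e1 (pre _ _)] at h3
  exact Set.disjoint_left.1 hBB' hq h3

end

end NPHMC

/-! ### Exclusion of deterministic cycles -/

theorem mainTheorem5 (w : NPHMC.Trace → ℝ) (hw : NPHMC.StandingAssumptions w)
    (A : Set NPHMC.Trace) (hA : NPHMC.ConvergenceAssumptions w A)
    (ε : ℝ) (hε : 0 < ε) (L : ℕ) (hL : 1 ≤ L) :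
    NPHMC.IsAperiodic (NPHMC.target w) (NPHMC.marginalKernel w ε L) := by
  rintro ⟨d, B, hd, hBm, hdisj, hB0, hQ⟩
  have hne : ∀ i : Fin (d + 1), i ≠ i + 1 := by
    obtain ⟨d, rfl⟩ := Nat.exists_eq_succ_of_ne_zero (by omega : d ≠ 0)
    intro i hi
    simp at hi
  obtain ⟨n, hn⟩ := NPHMC.exists_stdNormal_ne_zero (hBm 0) hB0
  have hQ0 := hQ 0
  have hT := NPHMC.ae_exists_mem_valid hw.nonneg hw.tree hw.measurable (hBm 0) (hBm _) hQ0
  -- In dimension `0` there is no momentum to vary; the empty trace, if supported, can only return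
  -- to itself.
  rcases Nat.eq_zero_or_pos n with rfl | hpos
  · refine hn ?_
    have : {q : Fin 0 → ℝ | (⟨0, q⟩ : NPHMC.Trace) ∈ B 0} = ∅ :=
      Set.eq_empty_iff_forall_notMem.2 fun q => NPHMC.not_mem_of_marginalKernel_eq_one hw.nonneg
        hw.tree hw.measurable (hBm 0) (hBm _) (hdisj _ _ (hne 0)) hQ0 q
    rw [this, measure_empty]
  · exact NPHMC.not_ae_conserved hw hA hε hL hpos (NPHMC.measurable_sigmaMk n (hBm 0))
      (fun q hq => NPHMC.pos_of_marginalKernel_eq_one (hQ0 _ hq)) hn (hT n)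
      fun N hN => NPHMC.ae_conserved hw.nonneg hw.tree hw.measurable (hBm 0) (hBm _) (hBm _)
        (hdisj _ _ (hne 0)) (hdisj _ _ (hne _)) hQ0 (hQ _) hN
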